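/- \textbf{Theorem.} For a permutation $\tau$ of $[n]=\{1,\dots,n\}$, call $i\in[n]$ a \emph{low record} of $\tau$ if $\tau(j)>\tau(i)$ for all $j<i$, and let $\mathrm{lrec}(\tau)$ be the number of low records of $\tau$. A \emph{cycle type of size $n$} is a sequence $t=(t_1,\dots,t_n)$ of nonnegative integers with $\sum_{p=1}^n p\,t_p=n$; a permutation of $[n]$ is \emph{$t$-cyclic} if it has exactly $t_p$ cycles of length $p$ for each $p\in[n]$ (fixed points are cycles of length $1$). For each $n$, let $t^{(n)}$ be a cycle type of size $n$ and let $\tau_n$ be a uniformly random $t^{(n)}$-cyclic permutation. \begin{enumerate} \item If $t_1^{(n)}=\mathcal{O}(\sqrt n)$ then \[ \frac{\mathrm{lrec}(\tau_n)}{\log n}\xrightarrow[n\to\infty]{}1 \quad\text{in probability.} \] \item If $\sqrt n=o\big(t_1^{(n)}\big)$ and $t_1^{(n)}=o(n)$ then \[ \frac{\mathrm{lrec}(\tau_n)}{\log n-\log t_1^{(n)}}\xrightarrow[n\to\infty]{}2 \quad\text{in probability.} \] \item If $t_1^{(n)}=\Theta(n)$ then $\mathrm{lrec}(\tau_n)=\mathcal{O}_{\mathbf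 P}(1)$, that is, $\sup_{n}\mathbf P\big(\mathrm{lrec}(\tau_n)>M\big)\to0$ as $M\to+\infty$. \end{enumerate} -/

import Mathlib

open Filter Topology MeasureTheory ProbabilityTheory Asymptotics

/-- The finite set of permutations of `Fin n` carries the discrete σ-algebra. -/
instance instMeasurableSpacePermFin (n : ℕ) : MeasurableSpace (Equiv.Perm (Fin n)) := ⊤

instance instDiscreteMeasurableSpacePermFin (n : ℕ) :
    DiscreteMeasurableSpace (Equiv.Perm (Fin n)) := ⟨fun _ => trivial⟩

/-- A cycle type `(t₁, …, tₙ)` of size `n`, i.e. with `∑ p * tₚ = n`, is encoded as the partition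
of `n` in which the part `p` has multiplicity `tₚ`. -/
abbrev CycleTypeOfSize (n : ℕ) : Type := Nat.Partition n

/-- The entry `tₚ` of a cycle type: the number of `p`-cycles. -/
def CycleTypeOfSize.num {n : ℕ} (t : CycleTypeOfSize n) (p : ℕ) : ℕ := t.parts.count p

/-- The set of `t`-cyclic permutations: those with cycle type `t`, where fixed points are counted
as `1`-cycles. -/
def cyclicPerms {n : ℕ} (t : CycleTypeOfSize n) : Set (Equiv.Perm (Fin n)) :=
  {σ | σ.partition.parts = t.parts}

/-- `τ` is a uniform `t`-cyclic permutation: its law is the uniform probability measure on the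
set of `t`-cyclic permutations. -/
def IsUniformCyclic {n : ℕ} {Ω : Type*} [MeasurableSpace Ω] (P : Measure Ω)
    (t : CycleTypeOfSize n) (τ : Ω → Equiv.Perm (Fin n)) : Prop :=
  HasLaw τ (uniformOn (cyclicPerms t)) P

/-- The position `i` is a low record (left-to-right minimum) of `τ`. -/
def IsLowRecord {n : ℕ} (τ : Equiv.Perm (Fin n)) (i : Fin n) : Prop :=
  ∀ j : Fin n, j < i → τ i < τ j

/-- The number of low records of `τ`. -/
noncomputable def lrec {n : ℕ} (τ : Equiv.Perm (Fin n)) : ℕ :=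
  Nat.card {i : Fin n // IsLowRecord τ i}

/-- Convergence in probability to a constant `c` of real random variables `X n`, each defined on
its own probability space. -/
def TendstoInProbability {Ω : ℕ → Type*} [∀ n, MeasurableSpace (Ω n)] (P : ∀ n, Measure (Ω n))
    (X : ∀ n, Ω n → ℝ) (c : ℝ) : Prop :=
  ∀ ε : ℝ, 0 < ε → Tendsto (fun n => P n {ω | ε ≤ |X n ω - c|}) atTop (𝓝 0)

/-- `X n` is an `O_P(a n)`: `sup_n P(|X n| > a n * M) → 0` as `M → ∞`. -/
def IsBigOInProbability {Ω : ℕ → Type*} [∀ n, MeasurableSpace (Ω n)] (P : ∀ n, Measure (Ω n))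
    (X : ∀ n, Ω n → ℝ) (a : ℕ → ℝ) : Prop :=
  Tendsto (fun M : ℝ => ⨆ n, P n {ω | a n * M < |X n ω|}) atTop (𝓝 0)

/-! Let `r` be the number of fixed points. The argument counts inside the conjugacy class, using
only its invariance under conjugation and inversion. A given fixed point occurs with probability `r
/ n`, and a given off-diagonal point of the graph with probability at most `1 / (n - 1)`. Hence
boxes of side `κ`, of order `√n` when `r = O(√n)` and `n / r` when `r` is larger but sublinear, are
where the graph first comes near the origin.

For `m` slightly below `κ`, the box of side `m` is empty with high probability. Given this,
conjugating by a permutation of the first `m` positions only permutes the values there, so the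
record indicators at these positions have means `1 / (k + 1)` and are pairwise uncorrelated: they
contribute about `log κ` records (`sum_leftRecords_sub_sq_le`). By inversion, small values
contribute about `log κ` more, and emptiness of the box makes the two families disjoint.

The other records are negligible. A point in each of two thin strips along the axes and one in a
square of side `M` of order `κ` confine them to two boxes with a bounded expected number of points
(`lrec_le_leftRecords_add`). The total is `2 log κ` up to a negligible error, that is `log n` or `2
(log n - log r)`. When `r` is linear, a fixed point at a bounded position already bounds the number
of records. -/

/-! ### Exchangeable random subsets and a second-moment bound -/

section ExchangeableSubsets
open scoped Classical Finset

theorem sum_comp_equiv_of_mapsTo {T M : Type*} [AddCommMonoid M] (e : Equiv.Perm T)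
    {G : Finset T} (h : ∀ x ∈ G, e x ∈ G) (f : T → M) :
    ∑ x ∈ G, f (e x) = ∑ x ∈ G, f x := by
  have hG : G.map e.toEmbedding = G := by
    refine Finset.eq_of_subset_of_card_le (fun y hy => ?_) (by simp)
    obtain ⟨x, hx, rfl⟩ := Finset.mem_map.1 hy
    exact h x hx
  conv_rhs => rw [← hG, Finset.sum_map]
  rfl

theorem card_filter_comp_equiv {T : Type*} (e : Equiv.Perm T) {G : Finset T}
    (h : ∀ x ∈ G, e x ∈ G) {p q : T → Prop}
    [DecidablePred p] [DecidablePred q] (hpq : ∀ x ∈ G, q (e x) ↔ p x) :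
    #{x ∈ G | p x} = #{x ∈ G | q x} := by
  rw [Finset.card_filter, Finset.card_filter, ← sum_comp_equiv_of_mapsTo e h fun x => if q x then 1 else 0]
  exact Finset.sum_congr rfl fun x hx => by simp [hpq x hx]

theorem exists_perm_apply_eq_pair {α : Type*} {U : Finset α} {u v u' v' : α} (hu : u ∈ U)
    (hv : v ∈ U) (hu' : u' ∈ U) (hv' : v' ∈ U) (huv : u ≠ v) (huv' : u' ≠ v') :
    ∃ π : Equiv.Perm α, π u = u' ∧ π v = v' ∧ ∀ w ∉ U, π w = w := by
  have hw : Equiv.swap u u' v ∈ U := by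
    rw [Equiv.swap_apply_def]; split_ifs <;> assumption
  have hne : u' ≠ Equiv.swap u u' v := by
    intro h
    have := congrArg (Equiv.swap u u') h
    rw [Equiv.swap_apply_right, Equiv.swap_apply_self] at this
    exact huv this
  refine ⟨Equiv.swap (Equiv.swap u u' v) v' * Equiv.swap u u', ?_, ?_, fun w hwU => ?_⟩
  · rw [Equiv.Perm.mul_apply, Equiv.swap_apply_left, Equiv.swap_apply_of_ne_of_ne hne huv']
  · rw [Equiv.Perm.mul_apply, Equiv.swap_apply_left]
  · have h1 : ∀ {x}, x ∈ U → w ≠ x := fun hx h => hwU (h ▸ hx)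
    rw [Equiv.Perm.mul_apply, Equiv.swap_apply_of_ne_of_ne (h1 hu) (h1 hu'),
      Equiv.swap_apply_of_ne_of_ne (h1 hw) (h1 hv')]

/-- The family `S` of subsets of `U`, seen as a uniform random subset with `x ∈ G`, is
exchangeable under the permutations of `U`. -/
def ExchangeableOn {T α : Type*} (G : Finset T) (S : T → Finset α) (U : Finset α) : Prop :=
  ∀ π : Equiv.Perm α, (∀ w ∉ U, π w = w) →
    ∃ e : Equiv.Perm T, (∀ x ∈ G, e x ∈ G) ∧ ∀ x ∈ G, ∀ u, π u ∈ S (e x) ↔ u ∈ S x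

variable {T α : Type*} [DecidableEq α] {G : Finset T} {S : T → Finset α} {U : Finset α} {s : ℕ}

/-- Swaps make all points of `U` equally likely to be covered; double counting the incidences gives
the common value. -/
theorem ExchangeableOn.card_mem (h : ExchangeableOn G S U) (hU : ∀ x ∈ G, S x ⊆ U)
    (hs : ∀ x ∈ G, #(S x) = s) {u : α} (hu : u ∈ U) :
    #U * #{x ∈ G | u ∈ S x} = s * #G := by
  have h1 : ∀ v ∈ U, #{x ∈ G | v ∈ S x} = #{x ∈ G | u ∈ S x} := by
    intro v hv
    obtain ⟨e, he, heS⟩ := h (Equiv.swap v u) (fun w hw => Equiv.swap_apply_of_ne_of_ne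
      (fun h => hw (h ▸ hv)) (fun h => hw (h ▸ hu)))
    refine card_filter_comp_equiv e he fun x hx => ?_
    rw [← heS x hx v, Equiv.swap_apply_left]
  rw [← smul_eq_mul, ← Finset.sum_const, ← Finset.sum_congr rfl h1]
  simp_rw [Finset.card_filter]
  rw [Finset.sum_comm, mul_comm s, ← smul_eq_mul, ← Finset.sum_const]
  refine Finset.sum_congr rfl fun x hx => ?_
  rw [← Finset.card_filter, ← hs x hx, Finset.filter_mem_eq_inter,
    Finset.inter_eq_right.2 (hU x hx)]

/-- The same double count over ordered pairs of distinct points. The truncated subtractions are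
exact, since `k ≤ k * k`. -/
theorem ExchangeableOn.card_mem_pair (h : ExchangeableOn G S U) (hU : ∀ x ∈ G, S x ⊆ U)
    (hs : ∀ x ∈ G, #(S x) = s) {u v : α} (hu : u ∈ U) (hv : v ∈ U) (huv : u ≠ v) :
    (#U * #U - #U) * #{x ∈ G | u ∈ S x ∧ v ∈ S x} = (s * s - s) * #G := by
  have h1 : ∀ p ∈ U.offDiag,
      #{x ∈ G | p.1 ∈ S x ∧ p.2 ∈ S x} = #{x ∈ G | u ∈ S x ∧ v ∈ S x} := by
    intro p hp
    rw [Finset.mem_offDiag] at hp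
    obtain ⟨π, hπu, hπv, hπ⟩ := exists_perm_apply_eq_pair hp.1 hp.2.1 hu hv hp.2.2 huv
    obtain ⟨e, he, heS⟩ := h π hπ
    refine card_filter_comp_equiv e he fun x hx => ?_
    rw [← heS x hx, ← heS x hx, hπu, hπv]
  rw [← Finset.offDiag_card, ← smul_eq_mul, ← Finset.sum_const, ← Finset.sum_congr rfl h1]
  simp_rw [Finset.card_filter]
  rw [Finset.sum_comm, mul_comm (s * s - s), ← smul_eq_mul, ← Finset.sum_const]
  refine Finset.sum_congr rfl fun x hx => ?_
  rw [← Finset.card_filter, ← hs x hx, ← Finset.offDiag_card]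
  congr 1
  ext p
  simp only [Finset.mem_filter, Finset.mem_offDiag]
  exact ⟨fun h => ⟨h.2.1, h.2.2, h.1.2.2⟩, fun h => ⟨⟨hU x hx h.1, hU x hx h.2.1, h.2.2⟩, h.1, h.2.1⟩⟩

/-- An exchangeable random `s`-subset of `U` avoids `D` with probability at most
`#U / (s * #D)`. -/
theorem ExchangeableOn.card_disjoint_le (h : ExchangeableOn G S U) (hU : ∀ x ∈ G, S x ⊆ U)
    (hs : ∀ x ∈ G, #(S x) = s) {D : Finset α} (hD : D ⊆ U) :
    (s * #D : ℝ) * #{x ∈ G | Disjoint (S x) D} ≤ #U * #G := by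
  rcases G.eq_empty_or_nonempty with rfl | ⟨x₀, hx₀⟩
  · simp
  rcases (mul_nonneg s.cast_nonneg (#D).cast_nonneg : (0 : ℝ) ≤ s * #D).eq_or_lt with h0 | h0
  · rw [← h0, zero_mul]; positivity
  have hd0 : (0 : ℝ) < #D := by
    rcases (Nat.cast_nonneg (α := ℝ) #D).eq_or_lt with h1 | h1
    · simp [← h1] at h0
    · exact h1
  have hdN : (#D : ℝ) ≤ #U := by exact_mod_cast Finset.card_le_card hD
  have hsN : (s : ℝ) ≤ #U := by
    rw [← hs x₀ hx₀]; exact_mod_cast Finset.card_le_card (hU x₀ hx₀)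
  set N : ℝ := (#U : ℝ) with hN
  set g : ℝ := (#G : ℝ) with hg
  set d : ℝ := (#D : ℝ) with hd
  have hN0 : 0 < N := hd0.trans_le hdN
  have hg0 : 0 ≤ g := by positivity
  have hs0 : (0 : ℝ) ≤ s := by positivity
  let X : T → ℝ := fun x => ∑ u ∈ D, if u ∈ S x then 1 else 0
  have c1 : ∀ u ∈ D, (∑ x ∈ G, if u ∈ S x then (1 : ℝ) else 0) = s * g / N := by
    intro u hu
    rw [Finset.sum_boole, eq_div_iff hN0.ne', mul_comm]
    rw [hN, hg]
    exact_mod_cast h.card_mem hU hs (hD hu)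
  -- Negative correlation: `s (s - 1) / (N (N - 1)) ≤ s² / N²` because `s ≤ N`.
  have c2 : ∀ u ∈ D, ∀ v ∈ D, u ≠ v →
      (∑ x ∈ G, (if u ∈ S x then (1 : ℝ) else 0) * (if v ∈ S x then 1 else 0))
        ≤ s ^ 2 * g / N ^ 2 := by
    intro u hu v hv huv
    have hN1 : 1 < N := by
      rw [hN]; exact_mod_cast Finset.one_lt_card.2 ⟨u, hD hu, v, hD hv, huv⟩
    have key := h.card_mem_pair hU hs (hD hu) (hD hv) huv
    have key' : (N * N - N) * (#{x ∈ G | u ∈ S x ∧ v ∈ S x} : ℝ) = (s * s - s) * g := by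
      have := congrArg (Nat.cast (R := ℝ)) key
      rw [Nat.cast_mul, Nat.cast_mul, Nat.cast_sub (Nat.le_mul_self _),
        Nat.cast_sub (Nat.le_mul_self _), Nat.cast_mul, Nat.cast_mul] at this
      exact this
    have e1 : (∑ x ∈ G, (if u ∈ S x then (1 : ℝ) else 0) * (if v ∈ S x then 1 else 0))
        = #{x ∈ G | u ∈ S x ∧ v ∈ S x} := by
      rw [← Finset.sum_boole]
      exact Finset.sum_congr rfl fun x _ => by split_ifs <;> simp_all
    rw [e1, le_div_iff₀ (by positivity)]
    have h3 : 0 < N * N - N := by nlinarith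
    refine le_of_mul_le_mul_left ?_ h3
    calc (N * N - N) * ((#{x ∈ G | u ∈ S x ∧ v ∈ S x} : ℝ) * N ^ 2)
        = (s * s - s) * g * N ^ 2 := by rw [← key']; ring
      _ = (s * g * N) * (s * N - N) := by ring
      _ ≤ (s * g * N) * (s * N - s) := by gcongr
      _ = (N * N - N) * (s ^ 2 * g) := by ring
  set μ : ℝ := s * d / N with hμ
  have hμ0 : 0 < μ := div_pos h0 hN0
  have m1 : ∑ x ∈ G, X x = g * μ := by
    rw [Finset.sum_comm, Finset.sum_congr rfl c1, Finset.sum_const, nsmul_eq_mul, hμ]; ring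
  have m2 : ∑ x ∈ G, X x ^ 2 ≤ g * μ + g * μ ^ 2 := by
    have : ∀ x, X x ^ 2 = ∑ u ∈ D, ∑ v ∈ D,
        (if u ∈ S x then (1 : ℝ) else 0) * (if v ∈ S x then 1 else 0) := by
      intro x; rw [pow_two, Finset.sum_mul_sum]
    simp_rw [this]
    rw [Finset.sum_comm]
    have hu : ∀ u ∈ D, (∑ x ∈ G, ∑ v ∈ D,
        (if u ∈ S x then (1 : ℝ) else 0) * (if v ∈ S x then 1 else 0))
          ≤ s * g / N + d * (s ^ 2 * g / N ^ 2) := by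
      intro u hu
      rw [Finset.sum_comm, ← Finset.add_sum_erase D _ hu]
      refine add_le_add ?_ ?_
      · rw [← c1 u hu]
        exact Finset.sum_le_sum fun x _ => by split_ifs <;> simp
      · refine (Finset.sum_le_sum fun v hv => c2 u hu v (Finset.mem_of_mem_erase hv)
          (Finset.ne_of_mem_erase hv).symm).trans ?_
        rw [Finset.sum_const, nsmul_eq_mul]
        gcongr
        exact Nat.cast_le.2 (Finset.card_le_card (Finset.erase_subset _ _))
    refine (Finset.sum_le_sum hu).trans (le_of_eq ?_)
    rw [Finset.sum_const, nsmul_eq_mul, hμ]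
    ring
  -- Chebyshev: the variance is at most `μ`, and missing `D` is a deviation of `μ` from the mean.
  have cheb : μ ^ 2 * #{x ∈ G | Disjoint (S x) D} ≤ g * μ := by
    calc μ ^ 2 * #{x ∈ G | Disjoint (S x) D}
        = ∑ x ∈ G with Disjoint (S x) D, (X x - μ) ^ 2 := by
          rw [Finset.sum_congr rfl (g := fun _ => μ ^ 2), Finset.sum_const, nsmul_eq_mul, mul_comm]
          intro x hx
          have : X x = 0 := Finset.sum_eq_zero fun u hu =>
            if_neg fun hS => Finset.disjoint_left.1 (Finset.mem_filter.1 hx).2 hS hu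
          rw [this]; ring
      _ ≤ ∑ x ∈ G, (X x - μ) ^ 2 :=
          Finset.sum_le_sum_of_subset_of_nonneg (Finset.filter_subset _ _)
            fun _ _ _ => sq_nonneg _
      _ = ∑ x ∈ G, X x ^ 2 - 2 * μ * ∑ x ∈ G, X x + g * μ ^ 2 := by
          simp_rw [sub_sq]
          rw [Finset.sum_add_distrib, Finset.sum_sub_distrib, Finset.sum_const, nsmul_eq_mul,
            Finset.mul_sum]
          congr 2
          exact Finset.sum_congr rfl fun x _ => by ring
      _ ≤ g * μ := by rw [m1]; nlinarith
  have h4 : μ * #{x ∈ G | Disjoint (S x) D} ≤ g := by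
    refine le_of_mul_le_mul_left ?_ hμ0
    linarith
  have h5 : s * d = N * μ := by rw [hμ]; field_simp
  rw [h5, mul_assoc]
  exact mul_le_mul_of_nonneg_left h4 hN0.le

end ExchangeableSubsets

/-! ### Low records and box counts; box estimates on an invariant class -/

section LowRecords
open scoped Classical Finset

variable {n : ℕ}

/-- The number of points of the graph of `τ` in the box `[0, a) × [0, b)`. -/
noncomputable def boxCount (a b : ℕ) (τ : Equiv.Perm (Fin n)) : ℕ :=
  #{i : Fin n | i.1 < a ∧ (τ i).1 < b}

/-- The number of low records of `τ` among the first `m` positions. -/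
noncomputable def leftRecords (m : ℕ) (τ : Equiv.Perm (Fin n)) : ℕ :=
  #{i : Fin n | i.1 < m ∧ IsLowRecord τ i}

theorem lrec_eq_card (τ : Equiv.Perm (Fin n)) : lrec τ = #{i : Fin n | IsLowRecord τ i} := by
  rw [lrec, Nat.card_eq_fintype_card, Fintype.card_subtype]

theorem lrec_le (τ : Equiv.Perm (Fin n)) : lrec τ ≤ n := by
  rw [lrec_eq_card]
  exact (Finset.card_le_univ _).trans (Fintype.card_fin n).le

theorem perm_inv_apply_self {α : Type*} (π : Equiv.Perm α) (x : α) : π⁻¹ (π x) = x :=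
  π.symm_apply_apply x

theorem perm_apply_inv_self {α : Type*} (π : Equiv.Perm α) (x : α) : π (π⁻¹ x) = x :=
  π.apply_symm_apply x

theorem isLowRecord_inv (τ : Equiv.Perm (Fin n)) (i : Fin n) :
    IsLowRecord τ⁻¹ (τ i) ↔ IsLowRecord τ i := by
  simp only [IsLowRecord, perm_inv_apply_self]
  constructor
  · intro h j hj
    by_contra hlt
    rcases (not_lt.1 hlt).lt_or_eq with h1 | h1
    · have := h (τ j) h1
      rw [perm_inv_apply_self] at this
      exact lt_asymm hj this
    · exact hj.ne (τ.injective h1)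
  · intro h j hj
    by_contra hlt
    rcases (not_lt.1 hlt).lt_or_eq with h1 | h1
    · have := h _ h1
      rw [perm_apply_inv_self] at this
      exact lt_asymm hj this
    · rw [← h1, perm_apply_inv_self] at hj
      exact lt_irrefl _ hj

theorem card_filter_perm (τ : Equiv.Perm (Fin n)) (p : Fin n → Prop) [DecidablePred p] :
    #{i | p (τ i)} = #{i | p i} := by
  rw [Finset.card_filter, Finset.card_filter]
  exact Equiv.sum_comp τ fun i => if p i then 1 else 0

theorem leftRecords_inv (m : ℕ) (τ : Equiv.Perm (Fin n)) :
    leftRecords m τ⁻¹ = #{i : Fin n | (τ i).1 < m ∧ IsLowRecord τ i} := by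
  rw [leftRecords, ← card_filter_perm τ fun i => i.1 < m ∧ IsLowRecord τ⁻¹ i]
  simp_rw [isLowRecord_inv]

theorem boxCount_inv (a b : ℕ) (τ : Equiv.Perm (Fin n)) : boxCount a b τ⁻¹ = boxCount b a τ := by
  rw [boxCount, ← card_filter_perm τ fun i => i.1 < a ∧ (τ⁻¹ i).1 < b, boxCount]
  simp_rw [perm_inv_apply_self, and_comm]

theorem boxCount_pos_iff {a b : ℕ} {τ : Equiv.Perm (Fin n)} :
    0 < boxCount a b τ ↔ ∃ i : Fin n, i.1 < a ∧ (τ i).1 < b := by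
  rw [boxCount, Finset.card_pos]
  simp [Finset.Nonempty]

theorem boxCount_eq_zero_iff {a b : ℕ} {τ : Equiv.Perm (Fin n)} :
    boxCount a b τ = 0 ↔ ∀ i : Fin n, i.1 < a → b ≤ (τ i).1 := by
  rw [← not_iff_not, ← Ne, ← Nat.pos_iff_ne_zero, boxCount_pos_iff]
  push Not
  rfl

theorem card_val_lt {m : ℕ} (h : m ≤ n) : #{i : Fin n | i.1 < m} = m := by
  have := Fin.card_filter_val_lt (n := n) (m := m)
  rw [min_eq_right h] at this
  convert this

theorem card_val_lt_le (m : ℕ) : #{i : Fin n | i.1 < m} ≤ m := by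
  have := Fin.card_filter_val_lt (n := n) (m := m)
  refine le_trans (le_of_eq ?_) (min_le_right n m)
  convert this

/-- A record after a point of the box has a value below that point's; any other record has position
at most that point's. -/
theorem lrec_le_of_boxCount_pos {k : ℕ} {τ : Equiv.Perm (Fin n)} (h : 0 < boxCount k k τ) :
    lrec τ ≤ 2 * k := by
  obtain ⟨p, hp, hτp⟩ := boxCount_pos_iff.1 h
  have hsub : ({i : Fin n | IsLowRecord τ i} : Finset (Fin n)) ⊆
      ({i : Fin n | i.1 < k} : Finset (Fin n)) ∪ ({i : Fin n | (τ i).1 < k} : Finset (Fin n)) := by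
    intro i hi
    simp only [Finset.mem_filter, Finset.mem_univ, true_and, Finset.mem_union] at hi ⊢
    rcases lt_or_ge p i with h1 | h1
    · exact Or.inr ((Fin.lt_def.1 (hi p h1)).trans hτp)
    · exact Or.inl ((Fin.le_def.1 h1).trans_lt hp)
  rw [lrec_eq_card]
  refine (Finset.card_le_card hsub).trans ((Finset.card_union_le _ _).trans ?_)
  rw [card_filter_perm τ fun i => i.1 < k]
  have := card_val_lt_le (n := n) k
  omega

theorem leftRecords_add_le_lrec {m : ℕ} {τ : Equiv.Perm (Fin n)} (h : boxCount m m τ = 0) :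
    leftRecords m τ + leftRecords m τ⁻¹ ≤ lrec τ := by
  rw [leftRecords_inv, leftRecords, lrec_eq_card, ← Finset.card_union_of_disjoint]
  · refine Finset.card_le_card fun i hi => ?_
    simp only [Finset.mem_filter, Finset.mem_univ, true_and, Finset.mem_union] at hi ⊢
    tauto
  · rw [Finset.disjoint_left]
    intro i hi hi'
    simp only [Finset.mem_filter, Finset.mem_univ, true_and] at hi hi'
    have := boxCount_eq_zero_iff.1 h i hi.1
    omega

/-- A record lies weakly to the left of any given graph point or strictly below it. For a record
with position and value at least `m`, the two strip points force both coordinates below `b`, and the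
point of the `M`-square forces one of them below `M`. -/
theorem lrec_le_leftRecords_add {m b M : ℕ} {τ : Equiv.Perm (Fin n)} (h₁ : 0 < boxCount m b τ)
    (h₂ : 0 < boxCount m b τ⁻¹) (h₃ : 0 < boxCount M M τ) :
    lrec τ ≤ leftRecords m τ + leftRecords m τ⁻¹ + boxCount M b τ + boxCount M b τ⁻¹ := by
  rw [boxCount_inv] at h₂ ⊢
  obtain ⟨p, hp, hτp⟩ := boxCount_pos_iff.1 h₁
  obtain ⟨q, hq, hτq⟩ := boxCount_pos_iff.1 h₂
  obtain ⟨r, hr, hτr⟩ := boxCount_pos_iff.1 h₃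
  rw [leftRecords_inv, leftRecords, lrec_eq_card, boxCount, boxCount]
  refine le_trans (Finset.card_le_card (fun i hi => ?_)) ((Finset.card_union_le _ _).trans
    (add_le_add_left ((Finset.card_union_le _ _).trans
      (add_le_add_left (Finset.card_union_le _ _) _)) _))
  simp only [Finset.mem_filter, Finset.mem_univ, true_and, Finset.mem_union] at hi ⊢
  have e1 : p < i → (τ i).1 < (τ p).1 := hi p
  have e2 : q < i → (τ i).1 < (τ q).1 := hi q
  have e3 : r < i → (τ i).1 < (τ r).1 := hi r
  rw [Fin.lt_def] at e1 e2 e3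
  have hi' : IsLowRecord τ i := hi
  by_cases c1 : i.1 < m
  · exact Or.inl (Or.inl (Or.inl ⟨c1, hi⟩))
  by_cases c2 : (τ i).1 < m
  · exact Or.inl (Or.inl (Or.inr ⟨c2, hi⟩))
  have d1 : (τ i).1 < b := by have := e1 (by omega); omega
  have d2 : i.1 < b := by
    by_contra hc
    have := e2 (by omega)
    omega
  by_cases c3 : i.1 < M
  · exact Or.inl (Or.inr ⟨c3, d1⟩)
  · exact Or.inr ⟨d2, by have := e3 (by omega); omega⟩

/-- `C` is closed under conjugation and inversion, and its members have `r` fixed points. -/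
structure IsInvariantClass (C : Finset (Equiv.Perm (Fin n))) (r : ℕ) : Prop where
  conj : ∀ π, ∀ τ ∈ C, π * τ * π⁻¹ ∈ C
  inv : ∀ τ ∈ C, τ⁻¹ ∈ C
  fixed : ∀ τ ∈ C, #{i | τ i = i} = r

variable {C : Finset (Equiv.Perm (Fin n))} {r : ℕ}

theorem IsInvariantClass.card_filter_inv (hC : IsInvariantClass C r)
    (p : Equiv.Perm (Fin n) → Prop) [DecidablePred p] : #{τ ∈ C | p τ⁻¹} = #{τ ∈ C | p τ} :=
  card_filter_comp_equiv (Equiv.inv _) (fun τ hτ => hC.inv τ hτ) fun _ _ => Iff.rfl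

/-- Conjugation by `π` moves the fixed-point set by `π`. -/
theorem IsInvariantClass.exchangeableOn_fixed (hC : IsInvariantClass C r) :
    ExchangeableOn C (fun τ => ({i | τ i = i} : Finset (Fin n))) Finset.univ := by
  intro π _
  refine ⟨(MulAut.conj π).toEquiv, fun τ hτ => hC.conj π τ hτ, fun τ _ u => ?_⟩
  simp only [Finset.mem_filter, Finset.mem_univ, true_and]
  change π (τ (π⁻¹ (π u))) = π u ↔ _
  rw [perm_inv_apply_self, π.injective.eq_iff]

theorem IsInvariantClass.card_apply_self (hC : IsInvariantClass C r) (i : Fin n) :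
    n * #{τ ∈ C | τ i = i} = r * #C := by
  have := hC.exchangeableOn_fixed.card_mem (fun _ _ => Finset.subset_univ _) hC.fixed
    (Finset.mem_univ i)
  simpa using this

/-- A fixed point below `M` is a point of the box, so an empty box makes the exchangeable set of
fixed points miss the first `M` positions. -/
theorem IsInvariantClass.card_no_fixed_le (hC : IsInvariantClass C r) {M : ℕ} (hM : M ≤ n) :
    (r * M : ℝ) * #{τ ∈ C | boxCount M M τ = 0} ≤ n * #C := by
  have := hC.exchangeableOn_fixed.card_disjoint_le (fun _ _ => Finset.subset_univ _) hC.fixed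
    (Finset.subset_univ ({i : Fin n | i.1 < M} : Finset (Fin n)))
  rw [card_val_lt hM, Finset.card_univ, Fintype.card_fin] at this
  refine le_trans (mul_le_mul_of_nonneg_left (Nat.cast_le.2 (Finset.card_le_card
    fun τ hτ => ?_)) (by positivity)) this
  rw [Finset.mem_filter, boxCount_eq_zero_iff] at hτ
  refine Finset.mem_filter.2 ⟨hτ.1, Finset.disjoint_left.2 fun i hi hi' => ?_⟩
  simp only [Finset.mem_filter, Finset.mem_univ, true_and] at hi hi'
  have := hτ.2 i hi'
  rw [hi] at this
  omega

/-- Conjugating by permutations that fix `i` makes the `n - 1` values other than `i` equally likely,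
and these events are disjoint. -/
theorem IsInvariantClass.card_apply_ne_le (hC : IsInvariantClass C r) {i j : Fin n}
    (hij : i ≠ j) : (n - 1) * #{τ ∈ C | τ i = j} ≤ #C := by
  have h1 : ∀ k ∈ Finset.univ.erase i, #{τ ∈ C | τ i = k} = #{τ ∈ C | τ i = j} := by
    intro k hk
    obtain ⟨π, hπi, hπk, -⟩ := exists_perm_apply_eq_pair (Finset.mem_univ i) (Finset.mem_univ k)
      (Finset.mem_univ i) (Finset.mem_univ j) (Finset.ne_of_mem_erase hk).symm hij
    refine card_filter_comp_equiv (MulAut.conj π).toEquiv (fun τ hτ => hC.conj π τ hτ)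
      fun τ _ => ?_
    have : π⁻¹ i = i := Equiv.Perm.inv_eq_iff_eq.2 hπi.symm
    change π (τ (π⁻¹ i)) = j ↔ _
    rw [this, ← hπk, π.injective.eq_iff]
  have h2 : #(Finset.univ.erase i) = n - 1 := by
    rw [Finset.card_erase_of_mem (Finset.mem_univ i), Finset.card_univ, Fintype.card_fin]
  rw [← h2, ← smul_eq_mul, ← Finset.sum_const, ← Finset.sum_congr rfl h1,
    ← Finset.card_biUnion]
  · refine Finset.card_le_card fun τ hτ => ?_
    obtain ⟨k, -, hk⟩ := Finset.mem_biUnion.1 hτ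
    exact (Finset.mem_filter.1 hk).1
  · intro k _ l _ hkl
    refine Finset.disjoint_left.2 fun τ hτ hτ' => hkl ?_
    rw [← (Finset.mem_filter.1 hτ).2, (Finset.mem_filter.1 hτ').2]

/-- The expected number of points in a box. -/
theorem IsInvariantClass.sum_boxCount_le (hC : IsInvariantClass C r) (hn : 2 ≤ n) (a b : ℕ) :
    ∑ τ ∈ C, (boxCount a b τ : ℝ) ≤ (a * r / n + a * b / (n - 1)) * #C := by
  have hn0 : (0 : ℝ) < n := by positivity
  have hn1 : (0 : ℝ) < n - 1 := by
    have : (2 : ℝ) ≤ n := by exact_mod_cast hn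
    linarith
  set A : Finset (Fin n) := {i : Fin n | i.1 < a} with hA
  set B : Finset (Fin n) := {i : Fin n | i.1 < b} with hB
  have hAa : (#A : ℝ) ≤ a := Nat.cast_le.2 (card_val_lt_le a)
  have hBb : (#B : ℝ) ≤ b := Nat.cast_le.2 (card_val_lt_le b)
  -- Diagonal points are kept apart: their probability `r / n` can far exceed `1 / (n - 1)`.
  have h1 : ∀ τ : Equiv.Perm (Fin n),
      (boxCount a b τ : ℝ) ≤ ∑ i ∈ A, ((if τ i = i then (1 : ℝ) else 0) +
        ∑ j ∈ B.erase i, if τ i = j then (1 : ℝ) else 0) := by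
    intro τ
    have : boxCount a b τ = #{i ∈ A | τ i ∈ B} := by
      rw [boxCount, hA, Finset.filter_filter]
      simp [hB]
    rw [this, Finset.card_filter, Nat.cast_sum]
    refine Finset.sum_le_sum fun i _ => ?_
    rw [Finset.sum_ite_eq]
    by_cases h : τ i = i
    · simp [h]; split_ifs <;> simp
    · by_cases h' : τ i ∈ B <;> simp [h, h']
  have h2 : ∀ i ∈ A, (∑ τ ∈ C, if τ i = i then (1 : ℝ) else 0) = r / n * #C := by
    intro i _
    rw [Finset.sum_boole, div_mul_eq_mul_div, eq_div_iff hn0.ne', mul_comm]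
    exact_mod_cast hC.card_apply_self i
  have h3 : ∀ i ∈ A, ∀ j ∈ B.erase i,
      (∑ τ ∈ C, if τ i = j then (1 : ℝ) else 0) ≤ 1 / (n - 1) * #C := by
    intro i _ j hj
    rw [Finset.sum_boole, div_mul_eq_mul_div, le_div_iff₀ hn1, mul_comm, one_mul]
    have := hC.card_apply_ne_le (Finset.ne_of_mem_erase hj).symm
    rw [← Nat.cast_le (α := ℝ), Nat.cast_mul, Nat.cast_sub (by omega), Nat.cast_one] at this
    exact this
  calc ∑ τ ∈ C, (boxCount a b τ : ℝ)
      ≤ ∑ τ ∈ C, ∑ i ∈ A, ((if τ i = i then (1 : ℝ) else 0) +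
        ∑ j ∈ B.erase i, if τ i = j then (1 : ℝ) else 0) := Finset.sum_le_sum fun τ _ => h1 τ
    _ = ∑ i ∈ A, ((∑ τ ∈ C, if τ i = i then (1 : ℝ) else 0) +
        ∑ j ∈ B.erase i, ∑ τ ∈ C, if τ i = j then (1 : ℝ) else 0) := by
        rw [Finset.sum_comm]
        refine Finset.sum_congr rfl fun i _ => ?_
        rw [Finset.sum_add_distrib, Finset.sum_comm (s := C) (t := B.erase i)]
    _ ≤ ∑ i ∈ A, ((r / n * #C + b * (1 / (n - 1) * #C)) : ℝ) := by
        refine Finset.sum_le_sum fun i hi => add_le_add (h2 i hi).le ?_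
        refine (Finset.sum_le_sum (h3 i hi)).trans ?_
        rw [Finset.sum_const, nsmul_eq_mul]
        refine mul_le_mul_of_nonneg_right (le_trans ?_ hBb) (by positivity)
        exact Nat.cast_le.2 (Finset.card_le_card (Finset.erase_subset _ _))
    _ ≤ a * (r / n * #C + b * (1 / (n - 1) * #C)) := by
        rw [Finset.sum_const, nsmul_eq_mul]
        exact mul_le_mul_of_nonneg_right hAa (by positivity)
    _ = (a * r / n + a * b / (n - 1)) * #C := by ring

theorem IsInvariantClass.card_le_boxCount_le (hC : IsInvariantClass C r) (hn : 2 ≤ n) (a b : ℕ)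
    {y : ℝ} (hy : 0 < y) :
    (#{τ ∈ C | y ≤ boxCount a b τ} : ℝ) ≤ (a * r / n + a * b / (n - 1)) / y * #C := by
  rw [div_mul_eq_mul_div, le_div_iff₀ hy]
  refine le_trans ?_ (hC.sum_boxCount_le hn a b)
  rw [← nsmul_eq_mul, ← Finset.sum_const]
  refine (Finset.sum_le_sum fun τ hτ => (Finset.mem_filter.1 hτ).2).trans ?_
  exact Finset.sum_le_sum_of_subset_of_nonneg (Finset.filter_subset _ _)
    fun _ _ _ => Nat.cast_nonneg _

/-- Conjugation by a permutation that preserves `{i | i < m}`. -/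
theorem boxCount_conj_eq_zero {m : ℕ} {π τ : Equiv.Perm (Fin n)}
    (hπ : ∀ i, (π i).1 < m ↔ i.1 < m) (hτ : boxCount m m τ = 0) :
    boxCount m m (π * τ * π⁻¹) = 0 := by
  rw [boxCount_eq_zero_iff] at hτ ⊢
  intro i hi
  have h1 : (π⁻¹ i).1 < m := by rwa [← hπ, perm_apply_inv_self]
  have h2 := hτ _ h1
  rw [Equiv.Perm.mul_apply, Equiv.Perm.mul_apply, ← not_lt, hπ, not_lt]
  exact h2

/-- Conjugation by permutations fixing every `i < m` preserves both the class and the emptiness of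
the `m`-box. Under it the image of the first `m` positions is an exchangeable `m`-subset of the
values at least `m`, and the second-moment bound applies to `D`, the values in `[m, b)`. -/
theorem IsInvariantClass.card_boxCount_eq_zero_le (hC : IsInvariantClass C r) {m b : ℕ}
    (hmb : m ≤ b) (hb : b ≤ n) :
    (m * (b - m : ℕ) : ℝ) * #{τ ∈ C | boxCount m m τ = 0 ∧ boxCount m b τ = 0} ≤ n * #C := by
  set G : Finset (Equiv.Perm (Fin n)) := {τ ∈ C | boxCount m m τ = 0} with hG
  set A : Finset (Fin n) := {i : Fin n | i.1 < m} with hA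
  set U : Finset (Fin n) := {i : Fin n | m ≤ i.1} with hU
  set D : Finset (Fin n) := {i ∈ U | i.1 < b} with hD
  have hex : ExchangeableOn G (fun τ => A.map τ.toEmbedding) U := by
    intro π hπ
    have hπ1 : ∀ i : Fin n, i.1 < m → π i = i := fun i hi => hπ i (by simp [hU, hi])
    have hπ2 : ∀ i, (π i).1 < m ↔ i.1 < m := by
      intro i
      refine ⟨fun h => ?_, fun h => by rwa [hπ1 i h]⟩
      have := π.injective (hπ1 _ h)
      rwa [this] at h
    refine ⟨(MulAut.conj π).toEquiv, fun τ hτ => ?_, fun τ hτ u => ?_⟩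
    · rw [hG, Finset.mem_filter] at hτ ⊢
      exact ⟨hC.conj π τ hτ.1, boxCount_conj_eq_zero hπ2 hτ.2⟩
    · simp only [Finset.mem_map, hA, Finset.mem_filter, Finset.mem_univ, true_and]
      refine exists_congr fun i => and_congr_right fun hi => ?_
      have : π⁻¹ i = i := Equiv.Perm.inv_eq_iff_eq.2 (hπ1 i hi).symm
      change π (τ (π⁻¹ i)) = π u ↔ τ i = u
      rw [this, π.injective.eq_iff]
  have hsub : ∀ τ ∈ G, A.map τ.toEmbedding ⊆ U := by
    intro τ hτ j hj
    obtain ⟨i, hi, rfl⟩ := Finset.mem_map.1 hj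
    rw [hG, Finset.mem_filter, boxCount_eq_zero_iff] at hτ
    simp only [hU, Finset.mem_filter, Finset.mem_univ, true_and]
    exact hτ.2 i (by simpa [hA] using hi)
  have hcard : ∀ τ ∈ G, #(A.map τ.toEmbedding) = m := fun τ _ => by
    rw [Finset.card_map, hA, card_val_lt (hmb.trans hb)]
  have hDc : #D = b - m := by
    have h1 : D = ({i : Fin n | i.1 < b} : Finset (Fin n)) \ A := by
      ext i; simp [hD, hU, hA, and_comm]
    rw [h1, Finset.card_sdiff_of_subset, card_val_lt hb, hA, card_val_lt (hmb.trans hb)]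
    intro i hi
    simp only [hA, Finset.mem_filter, Finset.mem_univ, true_and] at hi ⊢
    omega
  have key := hex.card_disjoint_le hsub hcard (Finset.filter_subset _ _ : D ⊆ U)
  rw [hDc] at key
  have h2 : ({τ ∈ C | boxCount m m τ = 0 ∧ boxCount m b τ = 0} : Finset _)
      ⊆ {τ ∈ G | Disjoint (A.map τ.toEmbedding) D} := by
    intro τ hτ
    rw [Finset.mem_filter] at hτ
    refine Finset.mem_filter.2 ⟨Finset.mem_filter.2 ⟨hτ.1, hτ.2.1⟩,
      Finset.disjoint_left.2 fun j hj hj' => ?_⟩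
    obtain ⟨i, hi, rfl⟩ := Finset.mem_map.1 hj
    have h3 := boxCount_eq_zero_iff.1 hτ.2.2 i (by simpa [hA] using hi)
    have h4 := (Finset.mem_filter.1 hj').2
    rw [Equiv.coe_toEmbedding] at h4
    omega
  refine le_trans (mul_le_mul_of_nonneg_left (Nat.cast_le.2 (Finset.card_le_card h2))
    (by positivity)) (key.trans ?_)
  have h5 : #U ≤ n := (Finset.card_le_univ _).trans (Fintype.card_fin n).le
  gcongr
  exact Finset.filter_subset _ _

end LowRecords

/-! ### First and second moments of the records when the box is empty -/

section RecordMoments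
open scoped Classical Finset

variable {n : ℕ}

/-- The indicator of a low record at `k`. -/
noncomputable def recordIndicator (k : Fin n) (τ : Equiv.Perm (Fin n)) : ℝ :=
  if IsLowRecord τ k then 1 else 0

theorem swap_val_lt_iff {m : ℕ} {a k : Fin n} (ha : a.1 < m) (hk : k.1 < m) (i : Fin n) :
    (Equiv.swap a k i).1 < m ↔ i.1 < m := by
  rw [Equiv.swap_apply_def]
  split_ifs with h1 h2
  · simp [h1, ha, hk]
  · simp [h2, ha, hk]
  · rfl

/-- With the box empty, the values at positions below `m` are at least `m`, so the outer swap leaves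
them alone and conjugation acts as precomposition. -/
theorem conj_swap_apply {m : ℕ} {τ : Equiv.Perm (Fin n)} (hτ : boxCount m m τ = 0) {a k : Fin n}
    (ha : a.1 < m) (hk : k.1 < m) {i : Fin n} (hi : i.1 < m) :
    MulAut.conj (Equiv.swap a k) τ i = τ (Equiv.swap a k i) := by
  rw [MulAut.conj_apply, Equiv.swap_inv, Equiv.Perm.mul_apply, Equiv.Perm.mul_apply]
  have h1 := boxCount_eq_zero_iff.1 hτ _ ((swap_val_lt_iff ha hk i).2 hi)
  refine Equiv.swap_apply_of_ne_of_ne (fun h => ?_) (fun h => ?_)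
  · rw [h] at h1; omega
  · rw [h] at h1; omega

theorem isLowRecord_conj_swap_self {m : ℕ} {τ : Equiv.Perm (Fin n)} (hτ : boxCount m m τ = 0)
    {a k : Fin n} (hak : a ≤ k) (hk : k.1 < m) :
    IsLowRecord (MulAut.conj (Equiv.swap a k) τ) k ↔ ∀ j ≤ k, j ≠ a → τ a < τ j := by
  have ha : a.1 < m := (Fin.le_def.1 hak).trans_lt hk
  rw [IsLowRecord, conj_swap_apply hτ ha hk hk, Equiv.swap_apply_right]
  constructor
  · intro h j hj hja
    rcases eq_or_ne j k with rfl | hjk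
    · have := h a (lt_of_le_of_ne hak hja.symm)
      rwa [conj_swap_apply hτ ha hk ha, Equiv.swap_apply_left] at this
    · have hjk' := lt_of_le_of_ne hj hjk
      have := h j hjk'
      rwa [conj_swap_apply hτ ha hk ((Fin.lt_def.1 hjk').trans hk),
        Equiv.swap_apply_of_ne_of_ne hja hjk] at this
  · intro h j hj
    rw [conj_swap_apply hτ ha hk ((Fin.lt_def.1 hj).trans hk)]
    rcases eq_or_ne j a with rfl | hja
    · rw [Equiv.swap_apply_left]
      exact h k le_rfl hj.ne'
    · rw [Equiv.swap_apply_of_ne_of_ne hja hj.ne]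
      exact h j hj.le hja

/-- Being a record at `k` depends on the earlier values only as a set, which a swap of two earlier
positions preserves. -/
theorem isLowRecord_conj_swap_of_lt {m : ℕ} {τ : Equiv.Perm (Fin n)} (hτ : boxCount m m τ = 0)
    {a j k : Fin n} (ha : a < k) (hj : j < k) (hk : k.1 < m) :
    IsLowRecord (MulAut.conj (Equiv.swap a j) τ) k ↔ IsLowRecord τ k := by
  have ha' : a.1 < m := (Fin.lt_def.1 ha).trans hk
  have hj' : j.1 < m := (Fin.lt_def.1 hj).trans hk
  rw [IsLowRecord, conj_swap_apply hτ ha' hj' hk, Equiv.swap_apply_of_ne_of_ne ha.ne' hj.ne']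
  constructor
  · intro h i hi
    have h1 : Equiv.swap a j i < k := (swap_val_lt_iff (m := k.1) ha hj i).2 hi
    have := h _ h1
    rwa [conj_swap_apply hτ ha' hj' ((Fin.lt_def.1 h1).trans hk), Equiv.swap_apply_self] at this
  · intro h i hi
    rw [conj_swap_apply hτ ha' hj' ((Fin.lt_def.1 hi).trans hk)]
    exact h _ ((swap_val_lt_iff (m := k.1) ha hj i).2 hi)

/-- Only the position of the minimum over `[0, k]`, once swapped into `k`, produces a record there.
-/
theorem sum_recordIndicator_conj_swap {m : ℕ} {τ : Equiv.Perm (Fin n)}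
    (hτ : boxCount m m τ = 0) {k : Fin n} (hk : k.1 < m) :
    ∑ a ∈ Finset.Iic k, recordIndicator k (MulAut.conj (Equiv.swap a k) τ) = 1 := by
  obtain ⟨a, ha, hmin⟩ := Finset.exists_min_image (Finset.Iic k) τ ⟨k, Finset.mem_Iic.2 le_rfl⟩
  rw [Finset.sum_eq_single a]
  · rw [recordIndicator, if_pos]
    rw [isLowRecord_conj_swap_self hτ (Finset.mem_Iic.1 ha) hk]
    exact fun j hj hja => lt_of_le_of_ne (hmin j (Finset.mem_Iic.2 hj))
      fun h => hja (τ.injective h).symm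
  · intro c hc hca
    rw [recordIndicator, if_neg]
    rw [isLowRecord_conj_swap_self hτ (Finset.mem_Iic.1 hc) hk]
    exact fun h => (h a (Finset.mem_Iic.1 ha) hca.symm).not_ge (hmin c hc)
  · exact fun h => absurd ha h

variable {C : Finset (Equiv.Perm (Fin n))} {r : ℕ}

theorem IsInvariantClass.conj_swap_mem (hC : IsInvariantClass C r) {m : ℕ} {a k : Fin n}
    (ha : a.1 < m) (hk : k.1 < m) : ∀ τ ∈ ({τ ∈ C | boxCount m m τ = 0} : Finset _),
      (MulAut.conj (Equiv.swap a k)).toEquiv τ ∈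
        ({τ ∈ C | boxCount m m τ = 0} : Finset (Equiv.Perm (Fin n))) := by
  intro τ hτ
  rw [Finset.mem_filter] at hτ ⊢
  exact ⟨hC.conj _ _ hτ.1, boxCount_conj_eq_zero (swap_val_lt_iff ha hk) hτ.2⟩

/-- Averaging over the `k + 1` conjugations by swaps with `k`. The weight `F`, invariant under them,
is there so that a later record indicator can be inserted. -/
theorem IsInvariantClass.sum_recordIndicator_mul (hC : IsInvariantClass C r) {m : ℕ}
    {k : Fin n} (hk : k.1 < m) (F : Equiv.Perm (Fin n) → ℝ)
    (hF : ∀ τ, boxCount m m τ = 0 → ∀ a ≤ k, F (MulAut.conj (Equiv.swap a k) τ) = F τ) :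
    ∑ τ ∈ C with boxCount m m τ = 0, recordIndicator k τ * F τ =
      1 / (k.1 + 1) * ∑ τ ∈ C with boxCount m m τ = 0, F τ := by
  have h1 : ∀ a ∈ Finset.Iic k, ∑ τ ∈ C with boxCount m m τ = 0,
      recordIndicator k (MulAut.conj (Equiv.swap a k) τ) * F τ =
        ∑ τ ∈ C with boxCount m m τ = 0, recordIndicator k τ * F τ := by
    intro a ha
    rw [Finset.mem_Iic] at ha
    rw [← sum_comp_equiv_of_mapsTo _
      (hC.conj_swap_mem ((Fin.le_def.1 ha).trans_lt hk) hk) fun τ => recordIndicator k τ * F τ]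
    refine Finset.sum_congr rfl fun τ hτ => ?_
    rw [← hF τ (Finset.mem_filter.1 hτ).2 a ha]
    rfl
  have h2 : ((k.1 : ℝ) + 1) * ∑ τ ∈ C with boxCount m m τ = 0, recordIndicator k τ * F τ =
      ∑ τ ∈ C with boxCount m m τ = 0, F τ := by
    have hcard : ((k.1 : ℝ) + 1) = #(Finset.Iic k) := by rw [Fin.card_Iic]; push_cast; rfl
    rw [hcard, ← nsmul_eq_mul, ← Finset.sum_const, ← Finset.sum_congr rfl h1, Finset.sum_comm]
    refine Finset.sum_congr rfl fun τ hτ => ?_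
    rw [← Finset.sum_mul, sum_recordIndicator_conj_swap (Finset.mem_filter.1 hτ).2 hk, one_mul]
  rw [← h2]
  field_simp

theorem IsInvariantClass.sum_recordIndicator (hC : IsInvariantClass C r) {m : ℕ}
    {k : Fin n} (hk : k.1 < m) :
    ∑ τ ∈ C with boxCount m m τ = 0, recordIndicator k τ =
      1 / (k.1 + 1) * #{τ ∈ C | boxCount m m τ = 0} := by
  have := hC.sum_recordIndicator_mul hk (fun _ => 1) (fun _ _ _ _ => rfl)
  simpa using this

theorem IsInvariantClass.sum_recordIndicator_pair (hC : IsInvariantClass C r) {m : ℕ}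
    {j k : Fin n} (hj : j.1 < m) (hk : k.1 < m) (hjk : j ≠ k) :
    ∑ τ ∈ C with boxCount m m τ = 0, recordIndicator j τ * recordIndicator k τ =
      1 / (j.1 + 1) * (1 / (k.1 + 1)) * #{τ ∈ C | boxCount m m τ = 0} := by
  wlog h : j < k generalizing j k
  · have := this hk hj hjk.symm (lt_of_le_of_ne (not_lt.1 h) hjk.symm)
    rw [mul_comm (1 / ((j.1 : ℝ) + 1)), ← this]
    exact Finset.sum_congr rfl fun τ _ => mul_comm _ _
  rw [hC.sum_recordIndicator_mul hj (recordIndicator k), hC.sum_recordIndicator hk, mul_assoc]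
  intro τ hτ a ha
  simp_rw [recordIndicator, isLowRecord_conj_swap_of_lt hτ (ha.trans_lt h) h hk]

theorem sum_val_lt_eq_harmonic {m : ℕ} (hm : m ≤ n) :
    ∑ k : Fin n with k.1 < m, 1 / ((k.1 : ℝ) + 1) = (harmonic m : ℝ) := by
  rw [harmonic, Rat.cast_sum]
  refine Finset.sum_bij (fun k _ => k.1) ?_ ?_ ?_ ?_
  · intro k hk; simpa using hk
  · intro a _ b _ h; exact Fin.ext h
  · intro b hb
    rw [Finset.mem_range] at hb
    exact ⟨⟨b, hb.trans_le hm⟩, by simpa using hb, rfl⟩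
  · intro k _; push_cast; rw [one_div]

/-- The centred indicators are uncorrelated, so only the diagonal variances survive, each at most
the mean `1 / (j + 1)`. -/
theorem IsInvariantClass.sum_leftRecords_sub_sq_le (hC : IsInvariantClass C r) {m : ℕ}
    (hm : m ≤ n) :
    ∑ τ ∈ C with boxCount m m τ = 0, ((leftRecords m τ : ℝ) - harmonic m) ^ 2 ≤
      harmonic m * #{τ ∈ C | boxCount m m τ = 0} := by
  set G : Finset (Equiv.Perm (Fin n)) := {τ ∈ C | boxCount m m τ = 0} with hG
  set J : Finset (Fin n) := {k : Fin n | k.1 < m} with hJ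
  have hJm : ∀ {k}, k ∈ J → k.1 < m := fun hk => (Finset.mem_filter.1 hk).2
  have h1 : ∀ τ : Equiv.Perm (Fin n), ((leftRecords m τ : ℝ) - harmonic m) ^ 2 =
      ∑ j ∈ J, ∑ k ∈ J, (recordIndicator j τ - 1 / ((j.1 : ℝ) + 1)) *
        (recordIndicator k τ - 1 / ((k.1 : ℝ) + 1)) := by
    intro τ
    rw [← Finset.sum_mul_sum, ← pow_two, Finset.sum_sub_distrib, sum_val_lt_eq_harmonic hm]
    congr 2
    simp_rw [recordIndicator]
    rw [Finset.sum_boole, leftRecords, hJ, Finset.filter_filter]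
  have h2 : ∀ j ∈ J, ∀ k ∈ J, k ≠ j →
      ∑ τ ∈ G, (recordIndicator j τ - 1 / ((j.1 : ℝ) + 1)) *
        (recordIndicator k τ - 1 / ((k.1 : ℝ) + 1)) = 0 := by
    intro j hj k hk hkj
    simp_rw [sub_mul, mul_sub]
    rw [Finset.sum_sub_distrib, Finset.sum_sub_distrib, Finset.sum_sub_distrib,
      hC.sum_recordIndicator_pair (hJm hj) (hJm hk) hkj.symm, ← Finset.sum_mul, ← Finset.mul_sum,
      hC.sum_recordIndicator (hJm hj), hC.sum_recordIndicator (hJm hk), Finset.sum_const,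
      nsmul_eq_mul]
    ring
  have h3 : ∀ j ∈ J, ∑ τ ∈ G, (recordIndicator j τ - 1 / ((j.1 : ℝ) + 1)) *
        (recordIndicator j τ - 1 / ((j.1 : ℝ) + 1)) ≤ 1 / ((j.1 : ℝ) + 1) * #G := by
    intro j hj
    have e : ∀ τ ∈ G, (recordIndicator j τ - 1 / ((j.1 : ℝ) + 1)) *
        (recordIndicator j τ - 1 / ((j.1 : ℝ) + 1)) =
          (1 - 2 * (1 / ((j.1 : ℝ) + 1))) * recordIndicator j τ + (1 / ((j.1 : ℝ) + 1)) ^ 2 := by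
      intro τ _
      rw [recordIndicator]
      split_ifs <;> ring
    rw [Finset.sum_congr rfl e, Finset.sum_add_distrib, ← Finset.mul_sum,
      hC.sum_recordIndicator (hJm hj), Finset.sum_const, nsmul_eq_mul]
    have : 0 ≤ (1 / ((j.1 : ℝ) + 1)) ^ 2 * #G := by positivity
    linarith
  simp_rw [h1]
  rw [Finset.sum_comm, ← sum_val_lt_eq_harmonic hm, Finset.sum_mul]
  refine Finset.sum_le_sum fun j hj => ?_
  rw [Finset.sum_comm, Finset.sum_eq_single_of_mem j hj (h2 j hj)]
  exact h3 j hj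

theorem IsInvariantClass.card_leftRecords_le (hC : IsInvariantClass C r) {m : ℕ} (hm : m ≤ n)
    {x : ℝ} (hx : 0 < x) :
    (#{τ ∈ C | boxCount m m τ = 0 ∧ x ≤ |(leftRecords m τ : ℝ) - harmonic m|} : ℝ) ≤
      harmonic m / x ^ 2 * #C := by
  have hH : (0 : ℝ) ≤ harmonic m := by
    rw [← sum_val_lt_eq_harmonic hm]; positivity
  rw [div_mul_eq_mul_div, le_div_iff₀ (by positivity), ← nsmul_eq_mul, ← Finset.sum_const]
  calc ∑ τ ∈ C with boxCount m m τ = 0 ∧ x ≤ |(leftRecords m τ : ℝ) - harmonic m|, x ^ 2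
      ≤ ∑ τ ∈ C with boxCount m m τ = 0 ∧ x ≤ |(leftRecords m τ : ℝ) - harmonic m|,
          ((leftRecords m τ : ℝ) - harmonic m) ^ 2 := by
        refine Finset.sum_le_sum fun τ hτ => ?_
        rw [← sq_abs (_ - _)]
        exact pow_le_pow_left₀ hx.le (Finset.mem_filter.1 hτ).2.2 2
    _ ≤ ∑ τ ∈ C with boxCount m m τ = 0, ((leftRecords m τ : ℝ) - harmonic m) ^ 2 := by
        refine Finset.sum_le_sum_of_subset_of_nonneg (fun τ hτ => ?_) fun _ _ _ => sq_nonneg _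
        rw [Finset.mem_filter] at hτ ⊢
        exact ⟨hτ.1, hτ.2.1⟩
    _ ≤ harmonic m * #{τ ∈ C | boxCount m m τ = 0} := hC.sum_leftRecords_sub_sq_le hm
    _ ≤ harmonic m * #C := by
        gcongr
        exact Finset.filter_subset _ _

/-- Deviation bound for the number of low records of a uniform element of an invariant class. -/
theorem IsInvariantClass.card_lrec_deviation_le (hC : IsInvariantClass C r) (hn : 2 ≤ n)
    {m b M : ℕ} (hm : 0 < m) (hmb : m < b) (hb : b ≤ n) {x y q : ℝ} (hx : 0 < x) (hy : 0 < y)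
    (hq : (#{τ ∈ C | boxCount m b τ ≠ 0 ∧ boxCount M M τ = 0} : ℝ) ≤ q * #C) :
    (#{τ ∈ C | 2 * x + 2 * y ≤ |(lrec τ : ℝ) - 2 * harmonic m|} : ℝ) ≤
      ((m * r / n + m * m / (n - 1)) + 2 * (harmonic m / x ^ 2) + 2 * (n / (m * (b - m))) + q +
        2 * ((M * r / n + M * b / (n - 1)) / y)) * #C := by
  let E₁ : Equiv.Perm (Fin n) → Prop := fun τ =>
    boxCount m m τ = 0 ∧ x ≤ |(leftRecords m τ : ℝ) - harmonic m|
  let E₂ : Equiv.Perm (Fin n) → Prop := fun τ => boxCount m m τ = 0 ∧ boxCount m b τ = 0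
  let E₃ : Equiv.Perm (Fin n) → Prop := fun τ => y ≤ boxCount M b τ
  have b0 : (#{τ ∈ C | (1 : ℝ) ≤ boxCount m m τ} : ℝ) ≤
      (m * r / n + m * m / (n - 1)) * #C := by
    simpa using hC.card_le_boxCount_le hn m m one_pos
  have b1 : (#{τ ∈ C | E₁ τ} : ℝ) ≤ harmonic m / x ^ 2 * #C :=
    hC.card_leftRecords_le (hmb.le.trans hb) hx
  have b2 : (#{τ ∈ C | E₂ τ} : ℝ) ≤ n / (m * (b - m)) * #C := by
    have h1 := hC.card_boxCount_eq_zero_le hmb.le hb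
    rw [Nat.cast_sub hmb.le] at h1
    have h2 : (0 : ℝ) < m * (b - m) :=
      mul_pos (by exact_mod_cast hm) (sub_pos.2 (by exact_mod_cast hmb))
    rw [div_mul_eq_mul_div, le_div_iff₀ h2, mul_comm]
    exact h1
  have b3 : (#{τ ∈ C | E₃ τ} : ℝ) ≤ (M * r / n + M * b / (n - 1)) / y * #C :=
    hC.card_le_boxCount_le hn M b hy
  -- Outside these eight events both sandwich inequalities for `lrec` apply. Events for `τ⁻¹` have
  -- the same cardinality as those for `τ`, whence the factors 2.
  have hsub : ({τ ∈ C | 2 * x + 2 * y ≤ |(lrec τ : ℝ) - 2 * harmonic m|} : Finset _) ⊆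
      {τ ∈ C | (1 : ℝ) ≤ boxCount m m τ} ∪ {τ ∈ C | E₁ τ} ∪ {τ ∈ C | E₁ τ⁻¹} ∪
        {τ ∈ C | E₂ τ} ∪ {τ ∈ C | E₂ τ⁻¹} ∪ {τ ∈ C | boxCount m b τ ≠ 0 ∧ boxCount M M τ = 0} ∪
          {τ ∈ C | E₃ τ} ∪ {τ ∈ C | E₃ τ⁻¹} := by
    intro τ hτ
    rw [Finset.mem_filter] at hτ
    obtain ⟨hτC, hτ⟩ := hτ
    by_contra hcon
    simp only [Finset.mem_union, Finset.mem_filter, hτC, true_and, not_or, E₁, E₂, E₃,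
      boxCount_inv m m] at hcon
    obtain ⟨⟨⟨⟨⟨⟨⟨c0, c1⟩, c2⟩, c3⟩, c4⟩, c5⟩, c6⟩, c7⟩ := hcon
    have z0 : boxCount m m τ = 0 := by
      by_contra h
      exact c0 (by exact_mod_cast Nat.one_le_iff_ne_zero.2 h)
    simp only [z0, true_and, not_le] at c1 c2 c3 c4 c6 c7
    have z5 : boxCount M M τ ≠ 0 := fun h => c5 ⟨c3, h⟩
    have l1 : (leftRecords m τ + leftRecords m τ⁻¹ : ℝ) ≤ lrec τ := by
      exact_mod_cast leftRecords_add_le_lrec z0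
    have l2 : (lrec τ : ℝ) ≤
        leftRecords m τ + leftRecords m τ⁻¹ + boxCount M b τ + boxCount M b τ⁻¹ := by
      exact_mod_cast lrec_le_leftRecords_add (Nat.pos_of_ne_zero c3) (Nat.pos_of_ne_zero c4)
        (Nat.pos_of_ne_zero z5)
    rw [abs_lt] at c1 c2
    have : |(lrec τ : ℝ) - 2 * harmonic m| < 2 * x + 2 * y := by
      rw [abs_lt]; constructor <;> linarith [c1.1, c1.2, c2.1, c2.2]
    exact absurd hτ (not_le.2 this)
  have hcard := (Finset.card_le_card hsub).trans
    ((Finset.card_union_le _ _).trans (Nat.add_le_add_right ((Finset.card_union_le _ _).trans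
    (Nat.add_le_add_right ((Finset.card_union_le _ _).trans
    (Nat.add_le_add_right ((Finset.card_union_le _ _).trans
    (Nat.add_le_add_right ((Finset.card_union_le _ _).trans
    (Nat.add_le_add_right ((Finset.card_union_le _ _).trans
    (Nat.add_le_add_right (Finset.card_union_le _ _) _)) _)) _)) _)) _)) _))
  rw [hC.card_filter_inv E₁, hC.card_filter_inv E₂, hC.card_filter_inv E₃] at hcard
  have hcard' := Nat.cast_le (α := ℝ) |>.2 hcard
  push_cast at hcard'
  linarith

end RecordMoments

/-! ### Conjugacy classes, and the deviation bound at scale `κ` -/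

section UniformCyclic
open scoped Classical Finset

variable {n : ℕ}

theorem partition_parts_conj (π τ : Equiv.Perm (Fin n)) :
    (π * τ * π⁻¹).partition.parts = τ.partition.parts := by
  rw [(Equiv.Perm.partition_eq_of_isConj (σ := π * τ * π⁻¹) (τ := τ)).1
    (isConj_iff.2 ⟨π⁻¹, by group⟩)]

theorem partition_parts_inv (τ : Equiv.Perm (Fin n)) :
    τ⁻¹.partition.parts = τ.partition.parts := by
  rw [Equiv.Perm.parts_partition, Equiv.Perm.parts_partition, Equiv.Perm.cycleType_inv,
    Equiv.Perm.support_inv]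

theorem count_one_partition_parts (τ : Equiv.Perm (Fin n)) :
    τ.partition.parts.count 1 = #{i | τ i = i} := by
  have h1 : Multiset.count 1 τ.cycleType = 0 := Multiset.count_eq_zero.2 fun h =>
    absurd (Equiv.Perm.two_le_of_mem_cycleType h) (by norm_num)
  have h2 : ({i | τ i = i} : Finset (Fin n)) = τ.supportᶜ := by ext i; simp
  rw [Equiv.Perm.parts_partition, Multiset.count_add, h1, zero_add, Multiset.count_replicate_self,
    h2, Finset.card_compl]

theorem isInvariantClass_cyclicPerms (t : CycleTypeOfSize n) :
    IsInvariantClass (cyclicPerms t).toFinset (t.num 1) where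
  conj π τ hτ := by
    rw [Set.mem_toFinset] at hτ ⊢
    exact (partition_parts_conj π τ).trans hτ
  inv τ hτ := by
    rw [Set.mem_toFinset] at hτ ⊢
    exact (partition_parts_inv τ).trans hτ
  fixed τ hτ := by
    rw [Set.mem_toFinset] at hτ
    rw [← count_one_partition_parts, CycleTypeOfSize.num, ← show τ.partition.parts = _ from hτ]

theorem IsUniformCyclic.measure_le {Ω : Type*} [MeasurableSpace Ω] {P : Measure Ω}
    {t : CycleTypeOfSize n} {τ : Ω → Equiv.Perm (Fin n)} (h : IsUniformCyclic P t τ)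
    {p : Equiv.Perm (Fin n) → Prop} {c : ℝ}
    (hc : (#{σ ∈ (cyclicPerms t).toFinset | p σ} : ℝ) ≤ c * #(cyclicPerms t).toFinset) :
    P {ω | p (τ ω)} ≤ ENNReal.ofReal c := by
  have h1 : P {ω | p (τ ω)} = uniformOn (cyclicPerms t) {σ | p σ} := by
    rw [← h.map_eq, Measure.map_apply_of_aemeasurable h.aemeasurable (MeasurableSet.of_discrete)]
    rfl
  have h2 : cyclicPerms t ∩ {σ | p σ} = ({σ ∈ (cyclicPerms t).toFinset | p σ} : Finset _) := by
    ext σ; simp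
  have h3 : Measure.count (cyclicPerms t) = #(cyclicPerms t).toFinset := by
    rw [← Measure.count_apply_finset, Set.coe_toFinset]
  rw [h1, uniformOn, cond_apply MeasurableSet.of_discrete, h2, mul_comm, ← div_eq_mul_inv]
  refine ENNReal.div_le_of_le_mul ?_
  rw [Measure.count_apply_finset, h3, ← ENNReal.ofReal_natCast, ← ENNReal.ofReal_natCast,
    ← ENNReal.ofReal_mul' (Nat.cast_nonneg _)]
  exact ENNReal.ofReal_le_ofReal hc

variable {C : Finset (Equiv.Perm (Fin n))} {r : ℕ}

/-- The parameter `W` separates scales: the `m`-box with `m = κ / W` is likely empty, while the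
wider strips and the square of side `8 W² κ` are likely hit. The first error term is small for large
`W`; with `W` fixed and `x`, `y` proportional to `log κ`, the others vanish as `κ` grows. The
alternative in `hn` says whether ordinary points or fixed points fill the square. -/
theorem IsInvariantClass.card_lrec_deviation_le_of_scale (hC : IsInvariantClass C r) {κ W : ℕ}
    {A x y : ℝ} (hW : 1 ≤ W) (hWκ : 8 * W ^ 2 ≤ κ) (hκn : κ ^ 2 ≤ n) (hκr : (κ * r : ℝ) ≤ A * n)
    (hn : n ≤ 4 * κ ^ 2 ∨ n ≤ 2 * κ * r) (hx : 0 < x) (hy : 0 < y) :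
    (#{τ ∈ C | 2 * x + 2 * y ≤ |(lrec τ : ℝ) - 2 * harmonic (κ / W)|} : ℝ) ≤
      ((A + 11) / W + 2 * ((1 + Real.log κ) / x ^ 2) +
        2 * ((8 * W ^ 2 * A + 32 * W ^ 4) / y)) * #C := by
  have hWW : W ≤ W ^ 2 := Nat.le_self_pow two_ne_zero W
  have hκ0 : 0 < κ := by omega
  have hκκ : κ ≤ κ ^ 2 := Nat.le_self_pow two_ne_zero κ
  have hn2 : 2 ≤ n := by omega
  obtain ⟨m, hm⟩ : ∃ m, m = κ / W := ⟨_, rfl⟩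
  obtain ⟨f, hf⟩ : ∃ f, f = n / κ := ⟨_, rfl⟩
  have hm1 : m * W ≤ κ := hm ▸ Nat.div_mul_le_self κ W
  have hm2 : κ ≤ 2 * m * W := by
    have h1 : κ < W * (m + 1) := hm ▸ Nat.lt_mul_div_succ κ hW
    have h2 : 1 ≤ m := hm ▸ (Nat.one_le_div_iff hW).2 (by omega)
    nlinarith
  have hm0 : 0 < m := Nat.pos_of_ne_zero fun h => by simp [h] at hm2; omega
  have hmκ : m ≤ κ := hm ▸ Nat.div_le_self κ W
  have hf1 : f * κ ≤ n := hf ▸ Nat.div_mul_le_self n κ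
  have hκf : κ ≤ f := hf ▸ (Nat.le_div_iff_mul_le hκ0).2 (by rwa [← pow_two])
  have hf2 : n ≤ 2 * f * κ := by
    have h1 : n < κ * (f + 1) := hf ▸ Nat.lt_mul_div_succ n hκ0
    nlinarith
  -- As `m ≥ κ / (2 W)` and `f ≥ n / (2 κ)`, this gives `m (b - m) / n ≥ W / 4`, hence the error `4
  -- / W` in `t4`.
  obtain ⟨b, hb⟩ : ∃ b, b = m + W ^ 2 * f := ⟨_, rfl⟩
  have hWf : f ≤ W ^ 2 * f := Nat.le_mul_of_pos_left f (by positivity)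
  have hb1 : b ≤ 2 * W ^ 2 * f := by rw [mul_assoc]; omega
  have hbn : b ≤ n := hb1.trans (le_trans (by nlinarith) hf1)
  have hmb : m < b := by omega
  have hW' : (1 : ℝ) ≤ W := by exact_mod_cast hW
  have hW0 : (0 : ℝ) < W := by linarith
  have hn' : (2 : ℝ) ≤ n := by exact_mod_cast hn2
  have hn0 : (0 : ℝ) < n := by linarith
  have hn1 : (0 : ℝ) < n - 1 := by linarith
  have hm1' : (m * W : ℝ) ≤ κ := by exact_mod_cast hm1
  have hm2' : (κ : ℝ) ≤ 2 * m * W := by exact_mod_cast hm2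
  have hm0' : (0 : ℝ) < m := by exact_mod_cast hm0
  have hf1' : (f * κ : ℝ) ≤ n := by exact_mod_cast hf1
  have hf2' : (n : ℝ) ≤ 2 * f * κ := by exact_mod_cast hf2
  have hf0' : (0 : ℝ) < f := by exact_mod_cast hκ0.trans_le hκf
  have hκn' : (κ ^ 2 : ℝ) ≤ n := by exact_mod_cast hκn
  have hb1' : (b : ℝ) ≤ 2 * W ^ 2 * f := by exact_mod_cast hb1
  have hbm : (b : ℝ) - m = W ^ 2 * f := by rw [hb]; push_cast; ring
  have hq : (#{τ ∈ C | boxCount m b τ ≠ 0 ∧ boxCount (8 * W ^ 2 * κ) (8 * W ^ 2 * κ) τ = 0} : ℝ)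
      ≤ 1 / W * #C := by
    -- If `n ≤ 4 κ²`, then `b ≤ 8 W² κ` and the strip lies in the square, so the event is
    -- impossible. Otherwise fixed points hit the square: their mean number there is at least `4
    -- W²`.
    rcases hn with h4 | h4
    · rw [Finset.filter_false_of_mem]
      · simp only [Finset.card_empty, Nat.cast_zero]; positivity
      · rintro τ - ⟨h5, h6⟩
        have hfκ : f ≤ 4 * κ := by
          refine le_of_mul_le_mul_right (hf1.trans (h4.trans (le_of_eq ?_))) hκ0
          ring
        have hbM : b ≤ 8 * W ^ 2 * κ := hb1.trans (by nlinarith)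
        obtain ⟨i, hi, hi'⟩ := boxCount_pos_iff.1 (Nat.pos_of_ne_zero h5)
        exact (boxCount_pos_iff.2 ⟨i, by omega, by omega⟩ : 0 < boxCount _ _ τ).ne' h6
    · have hMn : 8 * W ^ 2 * κ ≤ n := le_trans (by nlinarith) hκn
      have h5 := hC.card_no_fixed_le hMn
      have h6 : (n : ℝ) ≤ 2 * κ * r := by exact_mod_cast h4
      have h7 : (#{τ ∈ C | boxCount m b τ ≠ 0 ∧
          boxCount (8 * W ^ 2 * κ) (8 * W ^ 2 * κ) τ = 0} : ℝ) ≤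
          #{τ ∈ C | boxCount (8 * W ^ 2 * κ) (8 * W ^ 2 * κ) τ = 0} := by
        refine Nat.cast_le.2 (Finset.card_le_card fun τ hτ => ?_)
        rw [Finset.mem_filter] at hτ ⊢
        exact ⟨hτ.1, hτ.2.2⟩
      refine h7.trans ?_
      rw [div_mul_eq_mul_div, one_mul, le_div_iff₀ hW0]
      refine le_of_mul_le_mul_left (le_trans ?_ h5) hn0
      rw [← mul_assoc, mul_right_comm]
      refine mul_le_mul_of_nonneg_right ?_ (Nat.cast_nonneg _)
      push_cast
      calc (n * W : ℝ) ≤ (2 * κ * r) * (4 * W ^ 2) := by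
            refine mul_le_mul h6 ?_ hW0.le (by positivity)
            nlinarith
        _ = r * (8 * W ^ 2 * κ) := by ring
  rw [← hm]
  refine (hC.card_lrec_deviation_le hn2 hm0 hmb hbn hx hy hq).trans
    (mul_le_mul_of_nonneg_right ?_ (Nat.cast_nonneg _))
  have t1 : (m * r / n : ℝ) ≤ A / W := by
    rw [div_le_div_iff₀ hn0 hW0]
    calc (m * r * W : ℝ) = (m * W) * r := by ring
      _ ≤ κ * r := by gcongr
      _ ≤ A * n := hκr
  have t2 : (m * m / (n - 1) : ℝ) ≤ 2 / W := by
    rw [div_le_div_iff₀ hn1 hW0]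
    calc (m * m * W : ℝ) ≤ m * m * W * W := le_mul_of_one_le_right (by positivity) hW'
      _ = (m * W) ^ 2 := by ring
      _ ≤ κ ^ 2 := by gcongr
      _ ≤ n := hκn'
      _ ≤ 2 * (n - 1) := by linarith
  have t3 : (harmonic m : ℝ) / x ^ 2 ≤ (1 + Real.log κ) / x ^ 2 := by
    refine div_le_div_of_nonneg_right ((harmonic_le_one_add_log m).trans ?_) (by positivity)
    gcongr
  have t4 : (n / (m * (b - m)) : ℝ) ≤ 4 / W := by
    rw [hbm, div_le_div_iff₀ (by positivity) hW0]
    calc (n * W : ℝ) ≤ (2 * f * κ) * W := by gcongr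
      _ ≤ (2 * f * (2 * m * W)) * W := by gcongr
      _ = 4 * (m * (W ^ 2 * f)) := by ring
  have t5 : (((8 * W ^ 2 * κ : ℕ) : ℝ) * r / n + ((8 * W ^ 2 * κ : ℕ) : ℝ) * b / (n - 1)) / y ≤
      (8 * W ^ 2 * A + 32 * W ^ 4) / y := by
    refine div_le_div_of_nonneg_right (add_le_add ?_ ?_) hy.le
    · rw [div_le_iff₀ hn0]
      push_cast
      calc (8 * W ^ 2 * κ * r : ℝ) = 8 * W ^ 2 * (κ * r) := by ring
        _ ≤ 8 * W ^ 2 * (A * n) := by gcongr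
        _ = _ := by ring
    · rw [div_le_iff₀ hn1]
      push_cast
      calc (8 * W ^ 2 * κ * b : ℝ) ≤ 8 * W ^ 2 * κ * (2 * W ^ 2 * f) := by gcongr
        _ = 16 * W ^ 4 * (f * κ) := by ring
        _ ≤ 16 * W ^ 4 * n := by gcongr
        _ ≤ 16 * W ^ 4 * (2 * (n - 1)) := by gcongr; linarith
        _ = _ := by ring
  have t6 : (A + 11) / W = A / W + 2 / W + 2 * (4 / W) + 1 / (W : ℝ) := by ring
  linarith

theorem abs_harmonic_div_sub_log_le {κ W : ℕ} (hW : 1 ≤ W) (hWκ : W ≤ κ) :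
    |(harmonic (κ / W) : ℝ) - Real.log κ| ≤ 1 + Real.log W := by
  have hW0 : (0 : ℝ) < W := by exact_mod_cast hW
  have hκ0 : (0 : ℝ) < κ := by exact_mod_cast hW.trans hWκ
  have hm : 0 < κ / W := Nat.div_pos hWκ hW
  have hlW : 0 ≤ Real.log W := Real.log_nonneg (by exact_mod_cast hW)
  have h1 := harmonic_le_one_add_log (κ / W)
  have h2 := log_add_one_le_harmonic (κ / W)
  have h3 : Real.log ((κ / W : ℕ) : ℝ) ≤ Real.log κ :=
    Real.log_le_log (by exact_mod_cast hm) (by exact_mod_cast Nat.div_le_self κ W)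
  have h4 : Real.log κ - Real.log W ≤ Real.log ((κ / W + 1 : ℕ) : ℝ) := by
    rw [← Real.log_div hκ0.ne' hW0.ne']
    refine Real.log_le_log (by positivity) ?_
    rw [div_le_iff₀ hW0]
    exact_mod_cast (mul_comm W _ ▸ Nat.lt_mul_div_succ κ hW).le
  rw [abs_le]
  constructor <;> linarith

end UniformCyclic

/-! ### Passage to the limit and the three regimes -/

section Asymptotic
open scoped Classical Finset

variable {Ω : ℕ → Type*} [∀ n, MeasurableSpace (Ω n)] {P : ∀ n, Measure (Ω n)}
  {t : ∀ n, CycleTypeOfSize n} {τ : ∀ n, Ω n → Equiv.Perm (Fin n)}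

theorem tendsto_measure_lrec_deviation (hτ : ∀ n, IsUniformCyclic (P n) (t n) (τ n))
    {κ : ℕ → ℕ} (hκ : Tendsto κ atTop atTop) {A : ℝ} (h₁ : ∀ᶠ n in atTop, κ n ^ 2 ≤ n)
    (h₂ : ∀ᶠ n in atTop, (κ n * (t n).num 1 : ℝ) ≤ A * n)
    (h₃ : ∀ᶠ n in atTop, n ≤ 4 * κ n ^ 2 ∨ n ≤ 2 * κ n * (t n).num 1) {ε : ℝ} (hε : 0 < ε) :
    Tendsto (fun n => P n {ω | ε * Real.log (κ n) ≤ |(lrec (τ n ω) : ℝ) - 2 * Real.log (κ n)|})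
      atTop (𝓝 0) := by
  have hlog : Tendsto (fun n => Real.log (κ n)) atTop atTop :=
    Real.tendsto_log_atTop.comp (tendsto_natCast_atTop_atTop.comp hκ)
  have key : ∀ η : ℝ, 0 < η → ∀ᶠ n in atTop, P n {ω | ε * Real.log (κ n) ≤
      |(lrec (τ n ω) : ℝ) - 2 * Real.log (κ n)|} ≤ ENNReal.ofReal η := by
    intro η hη
    obtain ⟨W, hW1, hWη⟩ : ∃ W : ℕ, 1 ≤ W ∧ (A + 11) / W ≤ η / 2 :=
      ((eventually_ge_atTop 1).and ((tendsto_const_div_atTop_nhds_zero_nat (A + 11)).eventually_le_const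
        (half_pos hη))).exists
    -- With `x = y = δ log κ` the deviation is `(ε / 2) log κ`; the other half pays for replacing
    -- `harmonic (κ / W)` by `log κ`. `W` is fixed before `n` grows.
    set δ : ℝ := ε / 8 with hδ
    have hδ0 : 0 < δ := by positivity
    have e1 : ∀ᶠ n in atTop, (4 / δ ^ 2 + 2 * (8 * W ^ 2 * A + 32 * W ^ 4) / δ) /
        Real.log (κ n) ≤ η / 2 :=
      (hlog.const_div_atTop _).eventually_le_const (half_pos hη)
    filter_upwards [h₁, h₂, h₃, hκ.eventually_ge_atTop (8 * W ^ 2), e1,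
      hlog.eventually_ge_atTop 1, hlog.eventually_ge_atTop (4 * (1 + Real.log W) / ε)]
      with n n1 n2 n3 n4 n5 n6 n7
    have hWW : W ≤ W ^ 2 := Nat.le_self_pow two_ne_zero W
    have hl0 : 0 < Real.log (κ n) := by linarith
    have hx : 0 < δ * Real.log (κ n) := by positivity
    have h4 := (isInvariantClass_cyclicPerms (t n)).card_lrec_deviation_le_of_scale hW1 n4 n1 n2
      n3 hx hx
    refine le_trans (measure_mono fun ω hω => ?_) (((hτ n).measure_le h4).trans
      (ENNReal.ofReal_le_ofReal ?_))
    · have h5 := abs_harmonic_div_sub_log_le hW1 (by omega : W ≤ κ n)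
      rw [div_le_iff₀ hε] at n7
      simp only [Set.mem_ofPred_eq] at hω ⊢
      have h6 : |(lrec (τ n ω) : ℝ) - 2 * Real.log (κ n)| ≤
          |(lrec (τ n ω) : ℝ) - 2 * harmonic (κ n / W)| +
            2 * |(harmonic (κ n / W) : ℝ) - Real.log (κ n)| := by
        rw [← abs_two, ← abs_mul, abs_two]
        refine le_trans (le_of_eq ?_) (abs_add_le _ _)
        congr 1; ring
      rw [hδ]
      linarith
    · set l := Real.log (κ n)
      have h7 : (1 + l) / (δ * l) ^ 2 ≤ 2 / δ ^ 2 / l := by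
        rw [div_div, div_le_div_iff₀ (by positivity) (by positivity)]
        have : (1 + l) * (δ ^ 2 * l) ≤ (2 * l) * (δ ^ 2 * l) := by gcongr; linarith
        linarith
      have h8 : (4 / δ ^ 2 + 2 * (8 * W ^ 2 * A + 32 * W ^ 4) / δ) / l =
          2 * (2 / δ ^ 2 / l) + 2 * ((8 * W ^ 2 * A + 32 * W ^ 4) / (δ * l)) := by
        field_simp
        ring
      linarith
  rw [ENNReal.tendsto_nhds_zero]
  intro e he
  rcases eq_or_ne e ⊤ with rfl | hetop
  · exact Eventually.of_forall fun _ => le_top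
  · have := key e.toReal (ENNReal.toReal_pos he.ne' hetop)
    rwa [ENNReal.ofReal_toReal hetop] at this

theorem tendstoInProbability_lrec_div (hτ : ∀ n, IsUniformCyclic (P n) (t n) (τ n))
    {κ : ℕ → ℕ} (hκ : Tendsto κ atTop atTop) {A : ℝ} (h₁ : ∀ᶠ n in atTop, κ n ^ 2 ≤ n)
    (h₂ : ∀ᶠ n in atTop, (κ n * (t n).num 1 : ℝ) ≤ A * n)
    (h₃ : ∀ᶠ n in atTop, n ≤ 4 * κ n ^ 2 ∨ n ≤ 2 * κ n * (t n).num 1) {D : ℕ → ℝ} {B c : ℝ}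
    (hD : ∀ᶠ n in atTop, Real.log (κ n) ≤ D n)
    (hD' : ∀ᶠ n in atTop, |2 * Real.log (κ n) - c * D n| ≤ B) :
    TendstoInProbability P (fun n ω => (lrec (τ n ω) : ℝ) / D n) c := by
  intro ε hε
  have hlog : Tendsto (fun n => Real.log (κ n)) atTop atTop :=
    Real.tendsto_log_atTop.comp (tendsto_natCast_atTop_atTop.comp hκ)
  refine tendsto_of_tendsto_of_tendsto_of_le_of_le' tendsto_const_nhds
    (tendsto_measure_lrec_deviation hτ hκ h₁ h₂ h₃ (half_pos hε))
    (Eventually.of_forall fun _ => zero_le) ?_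
  filter_upwards [hD, hD', hlog.eventually_gt_atTop 0, hlog.eventually_ge_atTop (B / (ε / 2))]
    with n n1 n2 n3 n4
  refine measure_mono fun ω hω => ?_
  simp only [Set.mem_ofPred_eq] at hω ⊢
  have hD0 : 0 < D n := n3.trans_le n1
  have h4 : ε * D n ≤ |(lrec (τ n ω) : ℝ) - c * D n| := by
    have : (lrec (τ n ω) : ℝ) - c * D n = ((lrec (τ n ω) : ℝ) / D n - c) * D n := by
      field_simp
    rw [this, abs_mul, abs_of_pos hD0]
    gcongr
  have h5 : |(lrec (τ n ω) : ℝ) - c * D n| ≤ |(lrec (τ n ω) : ℝ) - 2 * Real.log (κ n)| +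
      |2 * Real.log (κ n) - c * D n| := abs_sub_le _ _ _
  have h6 : ε * Real.log (κ n) ≤ ε * D n := by gcongr
  rw [div_le_iff₀ (half_pos hε)] at n4
  linarith

theorem tendstoInProbability_lrec_of_few_fixed (hτ : ∀ n, IsUniformCyclic (P n) (t n) (τ n))
    (h : (fun n => ((t n).num 1 : ℝ)) =O[atTop] (fun n : ℕ => √(n : ℝ))) :
    TendstoInProbability P (fun n ω => (lrec (τ n ω) : ℝ) / Real.log n) 1 := by
  obtain ⟨A, hA⟩ := h.bound
  have hκ : Tendsto Nat.sqrt atTop atTop :=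
    tendsto_atTop_mono (fun n => Nat.le_sqrt'.2 (Nat.sqrt_le' n)) (tendsto_atTop_atTop.2 fun b =>
      ⟨b ^ 2, fun n hn => Nat.le_sqrt'.2 hn⟩)
  have hlog : ∀ᶠ n : ℕ in atTop, 0 ≤ Real.log (Nat.sqrt n) ∧
      2 * Real.log (Nat.sqrt n) ≤ Real.log n ∧
        Real.log n ≤ 2 * Real.log (Nat.sqrt n) + 2 * Real.log 2 := by
    filter_upwards [hκ.eventually_ge_atTop 1] with n hn
    have h0 : (1 : ℝ) ≤ Nat.sqrt n := by exact_mod_cast hn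
    have hn0 : (0 : ℝ) < n := by exact_mod_cast hn.trans (Nat.sqrt_le_self n)
    have e2 : 2 * Real.log (Nat.sqrt n) = Real.log ((Nat.sqrt n : ℝ) ^ 2) := by
      rw [Real.log_pow]; norm_num
    refine ⟨Real.log_nonneg h0, ?_, ?_⟩
    · rw [e2]
      exact Real.log_le_log (by positivity) (by exact_mod_cast Nat.sqrt_le' n)
    · rw [← mul_add, ← Real.log_mul (by positivity) (by norm_num)]
      have : 2 * Real.log (Nat.sqrt n * 2) = Real.log ((Nat.sqrt n * 2 : ℝ) ^ 2) := by
        rw [Real.log_pow]; norm_num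
      rw [this]
      refine Real.log_le_log hn0 ?_
      have h1 : (n : ℝ) ≤ (Nat.sqrt n + 1) ^ 2 := by exact_mod_cast (Nat.lt_succ_sqrt' n).le
      refine h1.trans (pow_le_pow_left₀ (by positivity) (by linarith) 2)
  -- Here `κ = ⌊√n⌋`, so `2 log κ` is `log n` up to a constant.
  refine tendstoInProbability_lrec_div hτ hκ (A := A) (B := 2 * Real.log 2)
    (Eventually.of_forall Nat.sqrt_le') ?_ ?_ ?_ ?_
  · filter_upwards [hA] with n hn
    rw [Real.norm_of_nonneg (Nat.cast_nonneg _), Real.norm_of_nonneg (Real.sqrt_nonneg _)] at hn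
    calc (Nat.sqrt n * (t n).num 1 : ℝ) ≤ √n * (A * √n) :=
          mul_le_mul Real.nat_sqrt_le_real_sqrt hn (Nat.cast_nonneg _) (Real.sqrt_nonneg _)
      _ = A * (√n * √n) := by ring
      _ = A * n := by rw [Real.mul_self_sqrt (Nat.cast_nonneg _)]
  · filter_upwards [hκ.eventually_ge_atTop 1] with n hn
    left
    have h1 := (Nat.lt_succ_sqrt' n).le
    rw [Nat.succ_eq_add_one] at h1
    nlinarith
  · filter_upwards [hlog] with n hn
    linarith [hn.1, hn.2.1]
  · filter_upwards [hlog] with n hn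
    rw [abs_le]
    constructor <;> linarith [hn.2.1, hn.2.2, Real.log_nonneg one_le_two]

theorem tendstoInProbability_lrec_of_many_fixed (hτ : ∀ n, IsUniformCyclic (P n) (t n) (τ n))
    (h : (fun n : ℕ => √(n : ℝ)) =o[atTop] (fun n => ((t n).num 1 : ℝ)))
    (h' : (fun n => ((t n).num 1 : ℝ)) =o[atTop] (fun n : ℕ => (n : ℝ))) :
    TendstoInProbability P
      (fun n ω => (lrec (τ n ω) : ℝ) / (Real.log n - Real.log ((t n).num 1))) 2 := by
  have hr : ∀ᶠ n : ℕ in atTop, √(n : ℝ) ≤ (t n).num 1 := by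
    filter_upwards [h.bound one_pos] with n hn
    rwa [Real.norm_of_nonneg (Nat.cast_nonneg _), Real.norm_of_nonneg (Real.sqrt_nonneg _),
      one_mul] at hn
  have hr0 : ∀ᶠ n : ℕ in atTop, 0 < (t n).num 1 := by
    filter_upwards [hr, eventually_gt_atTop 0] with n hn hn0
    have : 0 < √(n : ℝ) := Real.sqrt_pos.2 (by exact_mod_cast hn0)
    exact_mod_cast this.trans_le hn
  have hκ : Tendsto (fun n => n / (t n).num 1) atTop atTop := by
    refine tendsto_atTop.2 fun b => ?_
    filter_upwards [hr0, h'.bound (c := 1 / (b + 1)) (by positivity)] with n n1 n2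
    rw [Nat.le_div_iff_mul_le n1]
    rw [Real.norm_of_nonneg (Nat.cast_nonneg _), Real.norm_of_nonneg (Nat.cast_nonneg _),
      div_mul_eq_mul_div, one_mul, le_div_iff₀ (by positivity)] at n2
    have n3 : (t n).num 1 * (b + 1) ≤ n := by exact_mod_cast n2
    nlinarith
  have hle : ∀ n, n / (t n).num 1 * (t n).num 1 ≤ n := fun n => Nat.div_mul_le_self _ _
  have hge : ∀ᶠ n in atTop, n ≤ 2 * (n / (t n).num 1) * (t n).num 1 := by
    filter_upwards [hr0, hκ.eventually_ge_atTop 1] with n n1 n2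
    have h1 := (Nat.lt_mul_div_succ n n1).le
    nlinarith
  have hlog : ∀ᶠ n : ℕ in atTop,
      Real.log (n / (t n).num 1 : ℕ) ≤ Real.log n - Real.log ((t n).num 1) ∧
        Real.log n - Real.log ((t n).num 1) ≤ Real.log (n / (t n).num 1 : ℕ) + Real.log 2 := by
    filter_upwards [hr0, hκ.eventually_ge_atTop 1, hge, eventually_gt_atTop 0] with n n1 n2 n3 n4
    have m1 : (0 : ℝ) < (t n).num 1 := by exact_mod_cast n1
    have m2 : (0 : ℝ) < (n / (t n).num 1 : ℕ) := by exact_mod_cast n2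
    have m4 : (0 : ℝ) < n := by exact_mod_cast n4
    rw [← Real.log_div m4.ne' m1.ne', ← Real.log_mul m2.ne' two_ne_zero]
    constructor
    · refine Real.log_le_log m2 ?_
      rw [le_div_iff₀ m1]
      exact_mod_cast hle n
    · refine Real.log_le_log (by positivity) ?_
      rw [div_le_iff₀ m1]
      have : (n : ℝ) ≤ 2 * (n / (t n).num 1 : ℕ) * (t n).num 1 := by exact_mod_cast n3
      linarith
  -- Here `κ = ⌊n / r⌋`; the bound `κ² ≤ n` is where `√n ≤ r` enters.
  refine tendstoInProbability_lrec_div hτ hκ (A := 1) (B := 2 * Real.log 2) ?_ ?_ ?_ ?_ ?_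
  · filter_upwards [hr, eventually_gt_atTop 0] with n n1 n2
    have h0 : 0 < √(n : ℝ) := Real.sqrt_pos.2 (by exact_mod_cast n2)
    have h1 : ((n / (t n).num 1 : ℕ) : ℝ) ≤ √n := by
      refine le_of_mul_le_mul_right ?_ h0
      rw [Real.mul_self_sqrt (Nat.cast_nonneg _)]
      calc ((n / (t n).num 1 : ℕ) : ℝ) * √n ≤ (n / (t n).num 1 : ℕ) * (t n).num 1 := by gcongr
        _ ≤ n := by exact_mod_cast hle n
    have h2 := (Real.le_sqrt (Nat.cast_nonneg _) (Nat.cast_nonneg _)).1 h1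
    exact_mod_cast h2
  · refine Eventually.of_forall fun n => ?_
    rw [one_mul]
    exact_mod_cast hle n
  · filter_upwards [hge] with n hn using Or.inr hn
  · filter_upwards [hlog] with n hn using hn.1
  · filter_upwards [hlog] with n hn
    rw [abs_le]
    constructor <;> linarith [hn.1, hn.2, Real.log_nonneg one_le_two]

theorem isBigOInProbability_lrec_of_linear_fixed (hτ : ∀ n, IsUniformCyclic (P n) (t n) (τ n))
    (h : (fun n : ℕ => (n : ℝ)) =O[atTop] (fun n => ((t n).num 1 : ℝ))) :
    IsBigOInProbability P (fun n ω => (lrec (τ n ω) : ℝ)) (fun _ => 1) := by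
  obtain ⟨c, hc0, hc⟩ := h.exists_pos
  obtain ⟨N, hN⟩ := eventually_atTop.1 hc.bound
  have hfloor : Tendsto (fun M : ℝ => ⌊M / 2⌋₊) atTop atTop :=
    tendsto_nat_floor_atTop.comp (tendsto_id.atTop_div_const two_pos)
  have hlim : Tendsto (fun M : ℝ => ENNReal.ofReal (c / ⌊M / 2⌋₊)) atTop (𝓝 0) := by
    rw [← ENNReal.ofReal_zero]
    exact ENNReal.tendsto_ofReal ((tendsto_const_div_atTop_nhds_zero_nat c).comp hfloor)
  refine tendsto_of_tendsto_of_tendsto_of_le_of_le' tendsto_const_nhds hlim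
    (Eventually.of_forall fun _ => zero_le) ?_
  filter_upwards [eventually_ge_atTop (N : ℝ), eventually_ge_atTop (0 : ℝ),
    hfloor.eventually_ge_atTop 1] with M hM hM0 hk1
  refine iSup_le fun n => ?_
  set k := ⌊M / 2⌋₊ with hk
  have hkM : (2 * k : ℝ) ≤ M := by
    have := Nat.floor_le (div_nonneg hM0 two_pos.le)
    rw [← hk] at this
    linarith
  have hmono : {ω | 1 * M < |(lrec (τ n ω) : ℝ)|} ⊆ {ω | M < lrec (τ n ω)} := by
    intro ω hω
    rwa [Set.mem_ofPred_eq, one_mul, Nat.abs_cast] at hω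
  refine (measure_mono hmono).trans ((hτ n).measure_le (p := fun σ => M < lrec σ) ?_)
  have hempty : (∀ σ : Equiv.Perm (Fin n), ¬ M < lrec σ) →
      (#{σ ∈ (cyclicPerms (t n)).toFinset | M < lrec σ} : ℝ) ≤
        c / k * #(cyclicPerms (t n)).toFinset := by
    intro h0
    rw [Finset.filter_false_of_mem fun σ _ => h0 σ]
    simp only [Finset.card_empty, Nat.cast_zero]
    positivity
  have hlrec : ∀ σ : Equiv.Perm (Fin n), (lrec σ : ℝ) ≤ n := fun σ => by
    exact_mod_cast lrec_le σ
  -- The supremum runs over all `n`: below the threshold `N`, or below `k`, the trivial bound `lrec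
  -- ≤ n ≤ M` empties the event. Otherwise the probability that no fixed point lies below `k` is at
  -- most `n / (r k) ≤ c / k`.
  rcases lt_or_ge n N with hnN | hnN
  · refine hempty fun σ => not_lt.2 ((hlrec σ).trans (le_trans ?_ hM))
    exact_mod_cast hnN.le
  rcases lt_or_ge n k with hnk | hnk
  · refine hempty fun σ => not_lt.2 ((hlrec σ).trans (le_trans ?_ hkM))
    exact_mod_cast (by omega : n ≤ 2 * k)
  have h1 := hN n hnN
  rw [Real.norm_of_nonneg (Nat.cast_nonneg _), Real.norm_of_nonneg (Nat.cast_nonneg _)] at h1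
  have hn0 : (0 : ℝ) < n := by exact_mod_cast (by omega : 0 < n)
  have hr0 : (0 : ℝ) < (t n).num 1 := pos_of_mul_pos_right (hn0.trans_le h1) hc0.le
  have hk0 : (0 : ℝ) < k := by exact_mod_cast hk1
  have h2 := (isInvariantClass_cyclicPerms (t n)).card_no_fixed_le hnk
  rw [div_mul_eq_mul_div, le_div_iff₀ hk0]
  refine le_of_mul_le_mul_left ?_ hr0
  calc ((t n).num 1 : ℝ) * (#{σ ∈ (cyclicPerms (t n)).toFinset | M < lrec σ} * k)
      = (t n).num 1 * k * #{σ ∈ (cyclicPerms (t n)).toFinset | M < lrec σ} := by ring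
    _ ≤ (t n).num 1 * k * #{σ ∈ (cyclicPerms (t n)).toFinset | boxCount k k σ = 0} := by
        refine mul_le_mul_of_nonneg_left (Nat.cast_le.2 (Finset.card_le_card fun σ hσ => ?_))
          (by positivity)
        rw [Finset.mem_filter] at hσ ⊢
        refine ⟨hσ.1, ?_⟩
        by_contra h0
        have h3 : (lrec σ : ℝ) ≤ 2 * k := by
          exact_mod_cast lrec_le_of_boxCount_pos (Nat.pos_of_ne_zero h0)
        linarith [hσ.2]
    _ ≤ n * #(cyclicPerms (t n)).toFinset := h2
    _ ≤ (c * (t n).num 1) * #(cyclicPerms (t n)).toFinset := by gcongr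
    _ = (t n).num 1 * (c * #(cyclicPerms (t n)).toFinset) := by ring

end Asymptotic

theorem mainTheorem5 {Ω : ℕ → Type*} [∀ n, MeasurableSpace (Ω n)] (P : ∀ n, Measure (Ω n))
    [∀ n, IsProbabilityMeasure (P n)] (t : ∀ n, CycleTypeOfSize n)
    (τ : ∀ n, Ω n → Equiv.Perm (Fin n)) (hτ : ∀ n, IsUniformCyclic (P n) (t n) (τ n)) :
    ((fun n => ((t n).num 1 : ℝ)) =O[atTop] (fun n : ℕ => √(n : ℝ)) →
      TendstoInProbability P (fun n ω => (lrec (τ n ω) : ℝ) / Real.log n) 1) ∧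
    ((fun n : ℕ => √(n : ℝ)) =o[atTop] (fun n => ((t n).num 1 : ℝ)) →
      (fun n => ((t n).num 1 : ℝ)) =o[atTop] (fun n : ℕ => (n : ℝ)) →
      TendstoInProbability P
        (fun n ω => (lrec (τ n ω) : ℝ) / (Real.log n - Real.log ((t n).num 1))) 2) ∧
    ((fun n => ((t n).num 1 : ℝ)) =Θ[atTop] (fun n : ℕ => (n : ℝ)) →
      IsBigOInProbability P (fun n ω => (lrec (τ n ω) : ℝ)) (fun _ => 1)) :=
  ⟨tendstoInProbability_lrec_of_few_fixed hτ, tendstoInProbability_lrec_of_many_fixed hτ,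
    fun h => isBigOInProbability_lrec_of_linear_fixed hτ h.isBigO_symm⟩
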